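/- **The theory $\mathrm{HA}_{\to}$.** There are two sorts, $\iota$ (numbers) and $\kappa$ (classes). The symbols are $0$, $S$, $\mathrm{Pred}$, $+$, $\times$ on $\iota$; predicates $=$ on $\iota\times\iota$, $\mathrm{Null}$ and $N$ on $\iota$, $\in$ on $\iota\times\kappa$; and, for each proposition $P$ without $\in$ with free variables among $x,y_1,\dots,y_n$ of sort $\iota$, a function symbol $f_P$ of rank $\langle\iota,\dots,\iota,\kappa\rangle$ with $n$ arguments. There are no axioms; $\equiv$ is the congruence on terms and propositions generated by the rewrite rules $$y=z\to\forall p\,(y\in p\Rightarrow z\in p),\qquad N(n)\to\forall p\,(0\in p\Rightarrow\forall y\,(N(y)\Rightarrow y\in p\Rightarrow S(y)\in p)\Rightarrow n\in p),\qquad x\in f_P(y_1,\dots,y_n)\to P,$$ $$\mathrm{Pred}(0)\to0,\quad \mathrm{Pred}(S(x))\to x,\quad \mathrm{Null}(0)\to\top,\quad \mathrm{Null}(S(x))\to\bot,$$ $$0+y\to y,\quad S(x)+y\to S(x+y),\quad 0\times y\to0,\quad S(x)\times y\to x\times y+y.$$ **Proof-terms.** Proof-terms $\pi$ are those of intuitionistic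 natural deduction: $\alpha$, $\lambda\alpha\,\pi$, $(\pi\,\pi')$, $\langle\pi,\pi'\rangle$, $\mathit{fst}(\pi)$, $\mathit{snd}(\pi)$, $i(\pi)$, $j(\pi)$, $\delta(\pi_1,\alpha\pi_2,\beta\pi_3)$, $I$, $\delta_\bot(\pi)$, $\lambda x\,\pi$, $(\pi\,t)$, $\langle t,\pi\rangle$, $\delta_\exists(\pi,x\alpha\pi')$, where the variables $x$ are sorted. Reduction $\triangleright$ is the contextual closure of the rules $(\lambda\alpha\,\pi_1\ \pi_2)\triangleright(\pi_2/\alpha)\pi_1$; $(\lambda x\,\pi\ t)\triangleright(t/x)\pi$ for $t$ of the sort of $x$; $\mathit{fst}\langle\pi_1,\pi_2\rangle\triangleright\pi_1$; $\mathit{snd}\langle\pi_1,\pi_2\rangle\triangleright\pi_2$; $\delta(i(\pi_1),\alpha\pi_2,\beta\pi_3)\triangleright(\pi_1/\alpha)\pi_2$; $\delta(j(\pi_1),\alpha\pi_2,\beta\pi_3)\triangleright(\pi_1/\beta)\pi_3$; $\delta_\exists(\langle t,\pi_1\rangle,x\alpha\pi_2)\triangleright(t/x,\pi_1/\alpha)\pi_2$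 for $t$ of the sort of $x$. $\mathcal{SN}$ is the set of strongly normalizable proof-terms. A proof-term is neutral if it is a proof variable or an elimination. A reducibility candidate is a set $R\subseteq\mathcal{SN}$ of proof-terms that is closed under $\triangleright^*$ and contains each neutral proof-term all of whose one-step reducts are in $R$; $\mathcal{CR}$ is the set of candidates. **Pre-models.** A pre-model gives a set $M_s$ for each sort $s$, a function on these sets for each function symbol, and for each predicate symbol a function with values in $\mathcal{CR}$. Terms are interpreted as usual and propositions by $$\begin{aligned} [\![\top]\!]_\phi&=[\![\bot]\!]_\phi=\mathcal{SN},\\ [\![B\Rightarrow C]\!]_\phi&=\{\pi\in\mathcal{SN}\mid\pi\triangleright^*\lambda\alpha\,\pi'\text{ implies }(\sigma/\alpha)\pi'\in[\![C]\!]_\phi\text{ for all }\sigma\in[\![B]\!]_\phi\},\\ [\![B\wedge C]\!]_\phi&=\{\pi\in\mathcal{SN}\mid\pi\triangleright^*\langle\pi_1,\pi_2\rangle\text{ implies }\pi_1\in[\![B]\!]_\phi\text{ and }\pi_2\in[\![C]\!]_\phi\},\\ [\![B\vee C]\!]_\phi&=\{\pi\in\mathcal{SN}\mid\pi\triangleright^*i(\pi_1)\text{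 implies }\pi_1\in[\![B]\!]_\phi,\text{ and }\pi\triangleright^*j(\pi_2)\text{ implies }\pi_2\in[\![C]\!]_\phi\},\\ [\![\forall x\,B]\!]_\phi&=\{\pi\in\mathcal{SN}\mid\pi\triangleright^*\lambda x\,\pi'\text{ implies }(t/x)\pi'\in[\![B]\!]_{\phi,X/x}\text{ for all }X\in M_s\text{ and all terms }t\text{ of sort }s\},\\ [\![\exists x\,B]\!]_\phi&=\{\pi\in\mathcal{SN}\mid\pi\triangleright^*\langle t,\pi'\rangle\text{ implies }\pi'\in[\![B]\!]_{\phi,X/x}\text{ for some }X\in M_s\}, \end{aligned}$$ with $s$ the sort of $x$. A rewrite rule is valid if both sides have the same denotation for all assignments. A pre-model is a pre-model of $\equiv$ if $A\equiv B$ implies $[\![A]\!]_\phi=[\![B]\!]_\phi$ for all $\phi$. **Candidates.** For $A\subseteq\mathcal{SN}$ let $[A]$ be the least set that contains $A$, is closed under $\triangleright^*$, and contains each neutral proof-term all of whose one-step reducts it contains. Put $\bot\!\!\!\bot=[\emptyset]$ and $C_\sigma=[\{\sigma\}]$ for $\sigma\in\mathcal{SN}$. With $t$ ranging over the terms of sort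 $\kappa$, put $$E=\{\pi\in\mathcal{SN}\mid\forall t\ \forall\sigma\in\mathcal{SN}\ (\pi\,t\,\sigma)\in C_\sigma\},\qquad E'=\{\pi\in\mathcal{SN}\mid\forall t\ \forall\sigma\in\mathcal{SN}\ (\pi\,t\,\sigma)\in\bot\!\!\!\bot\}.$$ For proof-terms $\sigma_0,\sigma_S$ and a sequence $P=(P_n)_{n\in\mathbb N}$ of candidates let $$C_0^{\sigma_0,\sigma_S,P}=[\{\pi\mid\pi=\sigma_0\wedge\pi\in\mathcal{SN}\}],\qquad C_{n+1}^{\sigma_0,\sigma_S,P}=[\{(\sigma_S\,t\,\rho\,\pi)\in\mathcal{SN}\mid t\text{ a term of sort }\iota,\ \rho\in P_n,\ \pi\in C_n^{\sigma_0,\sigma_S,P}\}].$$ The pair $\langle\sigma_0,\sigma_S\rangle$ is $P$-Peano if $\sigma_0,\sigma_S\in\mathcal{SN}$ and $(\sigma_S\,t\,\rho\,\pi)\in\mathcal{SN}$ for all terms $t$ of sort $\iota$, all $n$, all $\rho\in P_n$ and all $\pi\in C_n^{\sigma_0,\sigma_S,P}$. Let $$\Phi(P)_n=\{\pi\in\mathcal{SN}\mid(\pi\,t\,\sigma_0\,\sigma_S)\in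 C_n^{\sigma_0,\sigma_S,P}\text{ for all terms }t\text{ of sort }\kappa\text{ and all }P\text{-Peano pairs }\langle\sigma_0,\sigma_S\rangle\}.$$ **The model.** Let $(P_n)$ be the intersection of all sequences $Q$ of candidates with $\Phi(Q)\subseteq Q$ (pointwise), and write $C_n^{\sigma_0,\sigma_S}$ for $C_n^{\sigma_0,\sigma_S,P}$. Put $M_\iota=\mathbb N$, with the usual $0,S,+,\times,\mathrm{Pred}$ (and $\mathrm{Pred}(0)=0$), $\widehat{\mathrm{Null}}(n)=\mathcal{SN}$, $\hat=(n,n)=E$, $\hat=(n,m)=E'$ if $n\ne m$, and $\hat N(n)=P_n$. A function $f$ on $\mathbb N$ is definable if there are a proposition $A$ without $\in$ and an assignment $\phi$ with $f(n)=[\![A]\!]_{\phi,n/x}$ for all $n$. Let $M_\kappa$ consist of the definable functions, the constant functions $C_\sigma$ with $\sigma\in\mathcal{SN}$, and the functions $k\mapsto C_k^{\sigma_0,\sigma_S}$ with $\sigma_0,\sigma_S$ proof-terms. Let $\hat\in(n,f)=f(n)$, and let $\hat f_A(b_1,\dots,b_n)$ be the function $k\mapsto[\![A]\!]_{k/x,b_1/y_1,\dots,b_n/y_n}$.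 (The denotation of a proposition without $\in$ is the same for every non-empty set $M_\kappa$, so that the definition is not circular.) **Theorem.** 1. $(P_n)$ is the least fixed point of $\Phi$ among the sequences of reducibility candidates. 2. $M_\kappa$ is a countable set of functions from $\mathbb N$ to $\mathcal{CR}$, and the construction yields a pre-model, in which the denotations of the propositions without $\in$ are those used to define $M_\kappa$. 3. The rule $y=z\to\forall p\,(y\in p\Rightarrow z\in p)$ is valid in this pre-model. 4. The rule $N(x)\to\forall p\,(0\in p\Rightarrow(\forall y\,(N(y)\Rightarrow y\in p\Rightarrow S(y)\in p))\Rightarrow x\in p)$ is valid in this pre-model. 5. It is a pre-model of the congruence $\equiv$ of $\mathrm{HA}_{\to}$. There are surjections $U:\mathbb N\to M_\kappa$, and for each of them the structure obtained by replacing $M_\kappa$ by $\mathbb N$, with $\hat\in(n,m)=U(m)(n)$ and with $\hat f_A$ taking as values chosen indices of the functions above, is also a pre-model of $\equiv$. 6. Consequently (cut elimination) every proof-term that is a proof of some proposition in some context, in intuitionistic natural deduction modulo $\equiv$, is strongly normalizable. -/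

import Mathlib

namespace HAMod

/-! ## The two-sorted language -/

/-- The sorts: `num` for numbers (written iota), `cls` for classes of numbers (written kappa). -/
inductive Srt : Type
  | num : Srt
  | cls : Srt
  deriving DecidableEq

/-- Families indexed by the sorts and by (de Bruijn) variables.  An assignment into the domains `D`
is such a family, and so is a substitution of terms for variables. -/
abbrev Env (D : Srt → Type) : Type := ∀ s, ℕ → D s

/-- Give the value `d` to variable `0` of sort `s` and shift the other variables of sort `s`. -/
def Env.push {D : Srt → Type} (φ : Env D) (s : Srt) (d : D s) : Env D :=
  Function.update φ s (fun n => Nat.casesOn n d (fun m => φ s m))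

/-- The sequence with first entries `b 0, …, b (n - 1)`, padded with `x`. -/
def pad {X : Type} (x : X) {n : ℕ} (b : Fin n → X) : ℕ → X :=
  fun i => if h : i < n then b ⟨i, h⟩ else x

/-- Terms of sort `num`. -/
inductive ITm : Type
  | var : ℕ → ITm
  | zero : ITm
  | succ : ITm → ITm
  | pred : ITm → ITm
  | add : ITm → ITm → ITm
  | mul : ITm → ITm → ITm

/-- Propositions; `K` is the type of the terms that may stand on the right of the membership symbol.
So `Fml Empty` is the type of the propositions without the symbol `∈`, and `Fml KTm` (below) is the
type of all propositions. -/
inductive Fml (K : Type) : Type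
  | eq : ITm → ITm → Fml K
  | null : ITm → Fml K
  | nat : ITm → Fml K
  | mem : ITm → K → Fml K
  | top : Fml K
  | bot : Fml K
  | imp : Fml K → Fml K → Fml K
  | and : Fml K → Fml K → Fml K
  | or : Fml K → Fml K → Fml K
  | all : Srt → Fml K → Fml K
  | ex : Srt → Fml K → Fml K

/-- All variables of the term have an index below `n`. -/
def ITm.Bdd (n : ℕ) : ITm → Prop
  | .var i => i < n
  | .zero => True
  | .succ a => a.Bdd n
  | .pred a => a.Bdd n
  | .add a b => a.Bdd n ∧ b.Bdd n
  | .mul a b => a.Bdd n ∧ b.Bdd n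

/-- All free variables of sort `num` have an index below `n`.  (A proposition without `∈` has
no free variable of sort `cls`.) -/
def Fml.Bdd : Fml Empty → ℕ → Prop
  | .eq a b, n => a.Bdd n ∧ b.Bdd n
  | .null a, n => a.Bdd n
  | .nat a, n => a.Bdd n
  | .mem _ k, _ => k.elim
  | .top, _ => True
  | .bot, _ => True
  | .imp A B, n => A.Bdd n ∧ B.Bdd n
  | .and A B, n => A.Bdd n ∧ B.Bdd n
  | .or A B, n => A.Bdd n ∧ B.Bdd n
  | .all .num A, n => A.Bdd (n + 1)
  | .all .cls A, n => A.Bdd n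
  | .ex .num A, n => A.Bdd (n + 1)
  | .ex .cls A, n => A.Bdd n

/-- Terms of sort `cls`: variables, and `f_{x, y₁, …, yₙ, P}(t₁, …, tₙ)` for each proposition `P`
without `∈` whose free variables are among `x` (index `0`) and `y₁, …, yₙ` (indices `1, …, n`). -/
inductive KTm : Type
  | var : ℕ → KTm
  | comp : (n : ℕ) → (P : Fml Empty) → P.Bdd (n + 1) → (Fin n → ITm) → KTm

/-- The terms of each sort. -/
abbrev Tm : Srt → Type
  | .num => ITm
  | .cls => KTm

/-- Variables as terms; this is also the identity substitution. -/
def Tm.var : Env Tm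
  | .num => ITm.var
  | .cls => KTm.var

/-! ### Substitution of terms -/

def ITm.subst (σ : Env Tm) : ITm → ITm
  | .var i => σ .num i
  | .zero => .zero
  | .succ a => .succ (a.subst σ)
  | .pred a => .pred (a.subst σ)
  | .add a b => .add (a.subst σ) (b.subst σ)
  | .mul a b => .mul (a.subst σ) (b.subst σ)

def KTm.subst (σ : Env Tm) : KTm → KTm
  | .var i => σ .cls i
  | .comp n P h ts => .comp n P h (fun i => (ts i).subst σ)

def Tm.subst (σ : Env Tm) : (s : Srt) → Tm s → Tm s
  | .num, t => ITm.subst σ t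
  | .cls, t => KTm.subst σ t

/-- The weakening that makes room for a new variable `0` of sort `s`. -/
def wk (s : Srt) : Env Tm := fun s' n => Tm.var s' (if s' = s then n + 1 else n)

/-- The substitution `σ` under a binder of sort `s`. -/
def up (s : Srt) (σ : Env Tm) : Env Tm :=
  Env.push (fun s' n => Tm.subst (wk s) s' (σ s' n)) s (Tm.var s 0)

/-- The substitution of `t` for variable `0` of sort `s`. -/
def inst (s : Srt) (t : Tm s) : Env Tm := Env.push Tm.var s t

/-- Simultaneous substitution in a proposition, given the substitution `k` in the right-hand sides
of membership propositions. -/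
def Fml.substWith {K : Type} (k : Env Tm → K → KTm) : Fml K → Env Tm → Fml KTm
  | .eq a b, σ => .eq (a.subst σ) (b.subst σ)
  | .null a, σ => .null (a.subst σ)
  | .nat a, σ => .nat (a.subst σ)
  | .mem a c, σ => .mem (a.subst σ) (k σ c)
  | .top, _ => .top
  | .bot, _ => .bot
  | .imp A B, σ => .imp (A.substWith k σ) (B.substWith k σ)
  | .and A B, σ => .and (A.substWith k σ) (B.substWith k σ)
  | .or A B, σ => .or (A.substWith k σ) (B.substWith k σ)
  | .all s A, σ => .all s (A.substWith k (up s σ))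
  | .ex s A, σ => .ex s (A.substWith k (up s σ))

/-- Propositions of the language of the theory. -/
abbrev Prp : Type := Fml KTm

def Prp.subst (σ : Env Tm) (A : Prp) : Prp := Fml.substWith KTm.subst A σ

/-! ## The rewrite rules and the congruence -/

/-- `∀ p, a ∈ p ⇒ b ∈ p`.  (Terms of sort `num` contain no variable of sort `cls`, so they need no
weakening under a binder of sort `cls`.) -/
def eqRhs (a b : ITm) : Prp :=
  .all .cls (.imp (.mem a (.var 0)) (.mem b (.var 0)))

/-- `∀ p, 0 ∈ p ⇒ (∀ y, N(y) ⇒ y ∈ p ⇒ S(y) ∈ p) ⇒ a ∈ p`. -/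
def natRhs (a : ITm) : Prp :=
  .all .cls (.imp (.mem .zero (.var 0))
    (.imp (.all .num (.imp (.nat (.var 0))
        (.imp (.mem (.var 0) (.var 0)) (.mem (.succ (.var 0)) (.var 0)))))
      (.mem a (.var 0))))

/-- The instance of `P` with `a` for variable `0` and `t₁, …, tₙ` for variables `1, …, n`. -/
def compRhs {n : ℕ} (P : Fml Empty) (a : ITm) (ts : Fin n → ITm) : Prp :=
  Fml.substWith (fun _ e => e.elim) P
    (Env.push (fun | .num => pad ITm.zero ts | .cls => KTm.var) .num a)

/-- Instances of the rewrite rules on terms. -/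
inductive ITm.Rule : ITm → ITm → Prop
  | pred_zero : Rule (.pred .zero) .zero
  | pred_succ (x : ITm) : Rule (.pred (.succ x)) x
  | zero_add (y : ITm) : Rule (.add .zero y) y
  | succ_add (x y : ITm) : Rule (.add (.succ x) y) (.succ (.add x y))
  | zero_mul (y : ITm) : Rule (.mul .zero y) .zero
  | succ_mul (x y : ITm) : Rule (.mul (.succ x) y) (.add (.mul x y) y)

/-- Instances of the rewrite rules on propositions. -/
inductive Prp.Rule : Prp → Prp → Prop
  | eq (a b : ITm) : Rule (.eq a b) (eqRhs a b)
  | nat (a : ITm) : Rule (.nat a) (natRhs a)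
  | comp (a : ITm) (n : ℕ) (P : Fml Empty) (h : P.Bdd (n + 1)) (ts : Fin n → ITm) :
      Rule (.mem a (.comp n P h ts)) (compRhs P a ts)
  | null_zero : Rule (.null .zero) .top
  | null_succ (x : ITm) : Rule (.null (.succ x)) .bot

/-- The congruence on terms of sort `num`. -/
inductive ITm.Cong : ITm → ITm → Prop
  | rule {a b : ITm} : ITm.Rule a b → Cong a b
  | refl (a : ITm) : Cong a a
  | symm {a b : ITm} : Cong a b → Cong b a
  | trans {a b c : ITm} : Cong a b → Cong b c → Cong a c
  | succ {a a' : ITm} : Cong a a' → Cong (.succ a) (.succ a')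
  | pred {a a' : ITm} : Cong a a' → Cong (.pred a) (.pred a')
  | add {a a' b b' : ITm} : Cong a a' → Cong b b' → Cong (.add a b) (.add a' b')
  | mul {a a' b b' : ITm} : Cong a a' → Cong b b' → Cong (.mul a b) (.mul a' b')

/-- The congruence on terms of sort `cls`. -/
inductive KTm.Cong : KTm → KTm → Prop
  | var (i : ℕ) : Cong (.var i) (.var i)
  | comp (n : ℕ) (P : Fml Empty) (h : P.Bdd (n + 1)) {ts ts' : Fin n → ITm} :
      (∀ i, ITm.Cong (ts i) (ts' i)) → Cong (.comp n P h ts) (.comp n P h ts')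

/-- The congruence on propositions generated by the rewrite rules. -/
inductive Prp.Cong : Prp → Prp → Prop
  | rule {A B : Prp} : Prp.Rule A B → Cong A B
  | refl (A : Prp) : Cong A A
  | symm {A B : Prp} : Cong A B → Cong B A
  | trans {A B C : Prp} : Cong A B → Cong B C → Cong A C
  | eq {a a' b b' : ITm} : ITm.Cong a a' → ITm.Cong b b' → Cong (.eq a b) (.eq a' b')
  | null {a a' : ITm} : ITm.Cong a a' → Cong (.null a) (.null a')
  | nat {a a' : ITm} : ITm.Cong a a' → Cong (.nat a) (.nat a')
  | mem {a a' : ITm} {c c' : KTm} : ITm.Cong a a' → KTm.Cong c c' → Cong (.mem a c) (.mem a' c')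
  | imp {A A' B B' : Prp} : Cong A A' → Cong B B' → Cong (.imp A B) (.imp A' B')
  | and {A A' B B' : Prp} : Cong A A' → Cong B B' → Cong (.and A B) (.and A' B')
  | or {A A' B B' : Prp} : Cong A A' → Cong B B' → Cong (.or A B) (.or A' B')
  | all (s : Srt) {A A' : Prp} : Cong A A' → Cong (.all s A) (.all s A')
  | ex (s : Srt) {A A' : Prp} : Cong A A' → Cong (.ex s A) (.ex s A')

/-! ## Proof-terms and their reduction -/

/-- Proof-terms, with de Bruijn indices for the proof variables and for the variables of each sort:
`case π₁ π₂ π₃` is `δ(π₁, α π₂, β π₃)`, `star` is `I`, `abort π` is `δ_⊥(π)`, `tlam s π` is `λx π`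
with `x` of sort `s`, `tapp s π t` is `(π t)`, `tpair s t π` is `⟨t, π⟩`, and `tcase s π π'` is
`δ_∃(π, x α π')`. -/
inductive PT : Type
  | var : ℕ → PT
  | lam : PT → PT
  | app : PT → PT → PT
  | pair : PT → PT → PT
  | fst : PT → PT
  | snd : PT → PT
  | inl : PT → PT
  | inr : PT → PT
  | case : PT → PT → PT → PT
  | star : PT
  | abort : PT → PT
  | tlam : Srt → PT → PT
  | tapp : (s : Srt) → PT → Tm s → PT
  | tpair : (s : Srt) → Tm s → PT → PT
  | tcase : Srt → PT → PT → PT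

/-- Substitution of terms in a proof-term. -/
def PT.tsubst : PT → Env Tm → PT
  | .var n, _ => .var n
  | .lam p, σ => .lam (p.tsubst σ)
  | .app p q, σ => .app (p.tsubst σ) (q.tsubst σ)
  | .pair p q, σ => .pair (p.tsubst σ) (q.tsubst σ)
  | .fst p, σ => .fst (p.tsubst σ)
  | .snd p, σ => .snd (p.tsubst σ)
  | .inl p, σ => .inl (p.tsubst σ)
  | .inr p, σ => .inr (p.tsubst σ)
  | .case p q r, σ => .case (p.tsubst σ) (q.tsubst σ) (r.tsubst σ)
  | .star, _ => .star
  | .abort p, σ => .abort (p.tsubst σ)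
  | .tlam s p, σ => .tlam s (p.tsubst (up s σ))
  | .tapp s p t, σ => .tapp s (p.tsubst σ) (Tm.subst σ s t)
  | .tpair s t p, σ => .tpair s (Tm.subst σ s t) (p.tsubst σ)
  | .tcase s p q, σ => .tcase s (p.tsubst σ) (q.tsubst (up s σ))

/-- A renaming of proof variables under a binder. -/
def liftRen (ξ : ℕ → ℕ) : ℕ → ℕ
  | 0 => 0
  | n + 1 => ξ n + 1

/-- Renaming of proof variables. -/
def PT.ren : PT → (ℕ → ℕ) → PT
  | .var n, ξ => .var (ξ n)
  | .lam p, ξ => .lam (p.ren (liftRen ξ))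
  | .app p q, ξ => .app (p.ren ξ) (q.ren ξ)
  | .pair p q, ξ => .pair (p.ren ξ) (q.ren ξ)
  | .fst p, ξ => .fst (p.ren ξ)
  | .snd p, ξ => .snd (p.ren ξ)
  | .inl p, ξ => .inl (p.ren ξ)
  | .inr p, ξ => .inr (p.ren ξ)
  | .case p q r, ξ => .case (p.ren ξ) (q.ren (liftRen ξ)) (r.ren (liftRen ξ))
  | .star, _ => .star
  | .abort p, ξ => .abort (p.ren ξ)
  | .tlam s p, ξ => .tlam s (p.ren ξ)
  | .tapp s p t, ξ => .tapp s (p.ren ξ) t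
  | .tpair s t p, ξ => .tpair s t (p.ren ξ)
  | .tcase s p q, ξ => .tcase s (p.ren ξ) (q.ren (liftRen ξ))

/-- A substitution of proof-terms under a binder of a proof variable. -/
def PT.upP (θ : ℕ → PT) : ℕ → PT
  | 0 => .var 0
  | n + 1 => (θ n).ren Nat.succ

/-- A substitution of proof-terms under a binder of a variable of sort `s`. -/
def PT.upT (s : Srt) (θ : ℕ → PT) : ℕ → PT := fun n => (θ n).tsubst (wk s)

/-- Substitution of proof-terms for proof variables. -/
def PT.subst : PT → (ℕ → PT) → PT
  | .var n, θ => θ n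
  | .lam p, θ => .lam (p.subst (upP θ))
  | .app p q, θ => .app (p.subst θ) (q.subst θ)
  | .pair p q, θ => .pair (p.subst θ) (q.subst θ)
  | .fst p, θ => .fst (p.subst θ)
  | .snd p, θ => .snd (p.subst θ)
  | .inl p, θ => .inl (p.subst θ)
  | .inr p, θ => .inr (p.subst θ)
  | .case p q r, θ => .case (p.subst θ) (q.subst (upP θ)) (r.subst (upP θ))
  | .star, _ => .star
  | .abort p, θ => .abort (p.subst θ)
  | .tlam s p, θ => .tlam s (p.subst (upT s θ))
  | .tapp s p t, θ => .tapp s (p.subst θ) t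
  | .tpair s t p, θ => .tpair s t (p.subst θ)
  | .tcase s p q, θ => .tcase s (p.subst θ) (q.subst (upP (upT s θ)))

/-- `p.inst0 q` is `(q/α) p`, where `α` is proof variable `0` of `p`. -/
def PT.inst0 (p q : PT) : PT := p.subst (fun n => Nat.casesOn n q PT.var)

/-- `p.tinst0 s t` is `(t/x) p`, where `x` is variable `0` of sort `s` of `p`. -/
def PT.tinst0 (p : PT) (s : Srt) (t : Tm s) : PT := p.tsubst (inst s t)

/-- One-step reduction. -/
inductive Step : PT → PT → Prop
  | beta (p q : PT) : Step (.app (.lam p) q) (p.inst0 q)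
  | tbeta (s : Srt) (p : PT) (t : Tm s) : Step (.tapp s (.tlam s p) t) (p.tinst0 s t)
  | fst_pair (p q : PT) : Step (.fst (.pair p q)) p
  | snd_pair (p q : PT) : Step (.snd (.pair p q)) q
  | case_inl (p q r : PT) : Step (.case (.inl p) q r) (q.inst0 p)
  | case_inr (p q r : PT) : Step (.case (.inr p) q r) (r.inst0 p)
  | tcase_tpair (s : Srt) (t : Tm s) (p q : PT) :
      Step (.tcase s (.tpair s t p) q) ((q.tinst0 s t).inst0 p)
  | lam {p p' : PT} : Step p p' → Step (.lam p) (.lam p')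
  | app_left {p p' : PT} (q : PT) : Step p p' → Step (.app p q) (.app p' q)
  | app_right (p : PT) {q q' : PT} : Step q q' → Step (.app p q) (.app p q')
  | pair_left {p p' : PT} (q : PT) : Step p p' → Step (.pair p q) (.pair p' q)
  | pair_right (p : PT) {q q' : PT} : Step q q' → Step (.pair p q) (.pair p q')
  | fst {p p' : PT} : Step p p' → Step (.fst p) (.fst p')
  | snd {p p' : PT} : Step p p' → Step (.snd p) (.snd p')
  | inl {p p' : PT} : Step p p' → Step (.inl p) (.inl p')
  | inr {p p' : PT} : Step p p' → Step (.inr p) (.inr p')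
  | case_scrut {p p' : PT} (q r : PT) : Step p p' → Step (.case p q r) (.case p' q r)
  | case_left (p : PT) {q q' : PT} (r : PT) : Step q q' → Step (.case p q r) (.case p q' r)
  | case_right (p q : PT) {r r' : PT} : Step r r' → Step (.case p q r) (.case p q r')
  | abort {p p' : PT} : Step p p' → Step (.abort p) (.abort p')
  | tlam (s : Srt) {p p' : PT} : Step p p' → Step (.tlam s p) (.tlam s p')
  | tapp (s : Srt) {p p' : PT} (t : Tm s) : Step p p' → Step (.tapp s p t) (.tapp s p' t)
  | tpair (s : Srt) (t : Tm s) {p p' : PT} : Step p p' → Step (.tpair s t p) (.tpair s t p')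
  | tcase_scrut (s : Srt) {p p' : PT} (q : PT) : Step p p' → Step (.tcase s p q) (.tcase s p' q)
  | tcase_body (s : Srt) (p : PT) {q q' : PT} : Step q q' → Step (.tcase s p q) (.tcase s p q')

/-- The reflexive-transitive closure of one-step reduction. -/
def Red : PT → PT → Prop := Relation.ReflTransGen Step

/-- The set of the strongly normalizable proof-terms. -/
def SN : Set PT := {p | Acc (fun a b => Step b a) p}

/-- Proof variables and eliminations. -/
def PT.Neutral : PT → Prop
  | .var _ => True
  | .app _ _ => True
  | .fst _ => True
  | .snd _ => True
  | .case _ _ _ => True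
  | .abort _ => True
  | .tapp _ _ _ => True
  | .tcase _ _ _ => True
  | .lam _ => False
  | .pair _ _ => False
  | .inl _ => False
  | .inr _ => False
  | .star => False
  | .tlam _ _ => False
  | .tpair _ _ _ => False

/-- Reducibility candidates. -/
structure IsCR (R : Set PT) : Prop where
  sn : ∀ p ∈ R, p ∈ SN
  red : ∀ p ∈ R, ∀ p', Red p p' → p' ∈ R
  neutral : ∀ p : PT, p.Neutral → (∀ p', Step p p' → p' ∈ R) → p ∈ R

/-! ## Natural deduction modulo the congruence -/

/-- `Proves Γ π A`: the proof-term `π` is a proof of `A` in the context `Γ`, in natural deduction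
modulo the congruence of the rewrite rules; entry `n` of `Γ` is the proposition assigned to proof
variable `n`. -/
inductive Proves : List Prp → PT → Prp → Prop
  | ax {Γ : List Prp} {n : ℕ} {A B : Prp} :
      Γ[n]? = some A → Prp.Cong A B → Proves Γ (.var n) B
  | imp_intro {Γ : List Prp} {p : PT} {A B C : Prp} :
      Prp.Cong C (.imp A B) → Proves (A :: Γ) p B → Proves Γ (.lam p) C
  | imp_elim {Γ : List Prp} {p q : PT} {A B C : Prp} :
      Prp.Cong C (.imp A B) → Proves Γ p C → Proves Γ q A → Proves Γ (.app p q) B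
  | and_intro {Γ : List Prp} {p q : PT} {A B C : Prp} :
      Prp.Cong C (.and A B) → Proves Γ p A → Proves Γ q B → Proves Γ (.pair p q) C
  | and_left {Γ : List Prp} {p : PT} {A B C : Prp} :
      Prp.Cong C (.and A B) → Proves Γ p C → Proves Γ (.fst p) A
  | and_right {Γ : List Prp} {p : PT} {A B C : Prp} :
      Prp.Cong C (.and A B) → Proves Γ p C → Proves Γ (.snd p) B
  | or_left {Γ : List Prp} {p : PT} {A B C : Prp} :
      Prp.Cong C (.or A B) → Proves Γ p A → Proves Γ (.inl p) C
  | or_right {Γ : List Prp} {p : PT} {A B C : Prp} :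
      Prp.Cong C (.or A B) → Proves Γ p B → Proves Γ (.inr p) C
  | or_elim {Γ : List Prp} {p q r : PT} {A B C D : Prp} :
      Prp.Cong D (.or A B) → Proves Γ p D → Proves (A :: Γ) q C → Proves (B :: Γ) r C →
      Proves Γ (.case p q r) C
  | top_intro {Γ : List Prp} {A : Prp} : Prp.Cong A .top → Proves Γ .star A
  | bot_elim {Γ : List Prp} {p : PT} {A B : Prp} :
      Prp.Cong B .bot → Proves Γ p B → Proves Γ (.abort p) A
  | all_intro {Γ : List Prp} {p : PT} {s : Srt} {A B : Prp} :
      Prp.Cong B (.all s A) → Proves (Γ.map (Prp.subst (wk s))) p A → Proves Γ (.tlam s p) B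
  | all_elim {Γ : List Prp} {p : PT} {s : Srt} {A B C : Prp} (t : Tm s) :
      Prp.Cong B (.all s A) → Prp.Cong C (Prp.subst (inst s t) A) → Proves Γ p B →
      Proves Γ (.tapp s p t) C
  | ex_intro {Γ : List Prp} {p : PT} {s : Srt} {A B C : Prp} (t : Tm s) :
      Prp.Cong B (.ex s A) → Prp.Cong C (Prp.subst (inst s t) A) → Proves Γ p C →
      Proves Γ (.tpair s t p) B
  | ex_elim {Γ : List Prp} {p q : PT} {s : Srt} {A B C : Prp} :
      Prp.Cong C (.ex s A) → Proves Γ p C →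
      Proves (A :: Γ.map (Prp.subst (wk s))) q (Prp.subst (wk s) B) →
      Proves Γ (.tcase s p q) B

/-! ## Pre-models -/

/-- The data of a pre-model of the language; see `PreModel.IsPreModel` for the requirement that
the denotations of the predicate symbols have reducibility candidates as values. -/
structure PreModel where
  D : Srt → Type
  zero : D .num
  succ : D .num → D .num
  pred : D .num → D .num
  add : D .num → D .num → D .num
  mul : D .num → D .num → D .num
  comp : (n : ℕ) → (P : Fml Empty) → P.Bdd (n + 1) → (Fin n → D .num) → D .cls
  eq : D .num → D .num → Set PT
  null : D .num → Set PT
  nat : D .num → Set PT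
  mem : D .num → D .cls → Set PT

/-- The predicate symbols denote functions with values in the reducibility candidates. -/
structure PreModel.IsPreModel (M : PreModel) : Prop where
  eq_cr : ∀ a b, IsCR (M.eq a b)
  null_cr : ∀ a, IsCR (M.null a)
  nat_cr : ∀ a, IsCR (M.nat a)
  mem_cr : ∀ a c, IsCR (M.mem a c)

def ITm.den (M : PreModel) (φ : Env M.D) : ITm → M.D .num
  | .var i => φ .num i
  | .zero => M.zero
  | .succ a => M.succ (a.den M φ)
  | .pred a => M.pred (a.den M φ)
  | .add a b => M.add (a.den M φ) (b.den M φ)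
  | .mul a b => M.mul (a.den M φ) (b.den M φ)

def KTm.den (M : PreModel) (φ : Env M.D) : KTm → M.D .cls
  | .var i => φ .cls i
  | .comp n P h ts => M.comp n P h (fun i => (ts i).den M φ)

/-- Denotation of propositions, given the denotation `k` of the right-hand sides of membership
propositions. -/
def Fml.denWith (M : PreModel) {K : Type} (k : Env M.D → K → M.D .cls) :
    Fml K → Env M.D → Set PT
  | .eq a b, φ => M.eq (a.den M φ) (b.den M φ)
  | .null a, φ => M.null (a.den M φ)
  | .nat a, φ => M.nat (a.den M φ)
  | .mem a c, φ => M.mem (a.den M φ) (k φ c)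
  | .top, _ => SN
  | .bot, _ => SN
  | .imp B C, φ => {p | p ∈ SN ∧
      ∀ p', Red p (.lam p') → ∀ q ∈ B.denWith M k φ, p'.inst0 q ∈ C.denWith M k φ}
  | .and B C, φ => {p | p ∈ SN ∧
      ∀ p₁ p₂, Red p (.pair p₁ p₂) → p₁ ∈ B.denWith M k φ ∧ p₂ ∈ C.denWith M k φ}
  | .or B C, φ => {p | p ∈ SN ∧ (∀ p₁, Red p (.inl p₁) → p₁ ∈ B.denWith M k φ) ∧
      (∀ p₂, Red p (.inr p₂) → p₂ ∈ C.denWith M k φ)}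
  | .all s B, φ => {p | p ∈ SN ∧ ∀ p', Red p (.tlam s p') →
      ∀ (X : M.D s) (t : Tm s), p'.tinst0 s t ∈ B.denWith M k (φ.push s X)}
  | .ex s B, φ => {p | p ∈ SN ∧ ∀ (t : Tm s) (p' : PT), Red p (.tpair s t p') →
      ∃ X : M.D s, p' ∈ B.denWith M k (φ.push s X)}

/-- Denotation of the propositions of the full language. -/
def PreModel.den (M : PreModel) (φ : Env M.D) (A : Prp) : Set PT :=
  A.denWith M (KTm.den M) φ

/-- Denotation of the propositions without the symbol `∈`. -/
def PreModel.den₀ (M : PreModel) (φ : Env M.D) (A : Fml Empty) : Set PT :=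
  A.denWith M (fun _ e => e.elim) φ

/-- `M` is a pre-model of the congruence defined by the rewrite rules. -/
def PreModel.ModelsCong (M : PreModel) : Prop :=
  ∀ A B : Prp, Prp.Cong A B → ∀ φ : Env M.D, M.den φ A = M.den φ B

/-! ## The construction of some candidates -/

/-- The inductive closure `[A]` of a set of proof-terms. -/
inductive Gen (A : Set PT) : PT → Prop
  | base {p : PT} : p ∈ A → Gen A p
  | red {p p' : PT} : Gen A p → Red p p' → Gen A p'
  | neutral {p : PT} : p.Neutral → (∀ p', Step p p' → Gen A p') → Gen A p

/-- The set `[A]`. -/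
def gen (A : Set PT) : Set PT := {p | Gen A p}

/-- The smallest reducibility candidate. -/
def botbot : Set PT := gen ∅

/-- The smallest reducibility candidate that contains the strongly normalizable proof-term `q`. -/
def Csingle (q : PT) : Set PT := gen {q}

def E : Set PT :=
  {p | p ∈ SN ∧ ∀ (t : Tm .cls), ∀ q ∈ SN, PT.app (.tapp .cls p t) q ∈ Csingle q}

def E' : Set PT :=
  {p | p ∈ SN ∧ ∀ (t : Tm .cls), ∀ q ∈ SN, PT.app (.tapp .cls p t) q ∈ botbot}

/-- The family `C_n^{σ₀, σS, P}`. -/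
def Cfam (σ₀ σS : PT) (P : ℕ → Set PT) : ℕ → Set PT
  | 0 => gen {p | p = σ₀ ∧ p ∈ SN}
  | n + 1 => gen {p | p ∈ SN ∧ ∃ (t : Tm .num), ∃ r ∈ P n, ∃ q ∈ Cfam σ₀ σS P n,
      p = .app (.app (.tapp .num σS t) r) q}

/-- `⟨σ₀, σS⟩` is a `P`-Peano pair. -/
def IsPeano (P : ℕ → Set PT) (σ₀ σS : PT) : Prop :=
  σ₀ ∈ SN ∧ σS ∈ SN ∧ ∀ (t : Tm .num) (n : ℕ), ∀ r ∈ P n, ∀ q ∈ Cfam σ₀ σS P n,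
    PT.app (.app (.tapp .num σS t) r) q ∈ SN

def Phi (P : ℕ → Set PT) (n : ℕ) : Set PT :=
  {p | p ∈ SN ∧ ∀ (t : Tm .cls) (σ₀ σS : PT), IsPeano P σ₀ σS →
    PT.app (.app (.tapp .cls p t) σ₀) σS ∈ Cfam σ₀ σS P n}

/-- The least fixed point of `Phi` in the complete order of the sequences of reducibility
candidates, as the pointwise intersection of all `Q` with `Phi Q ⊆ Q`. -/
def Pfam (n : ℕ) : Set PT :=
  {p | ∀ Q : ℕ → Set PT, (∀ k, IsCR (Q k)) → (∀ k, Phi Q k ⊆ Q k) → p ∈ Q n}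

/-! ## The pre-model -/

/-- The domains: the natural numbers for `num`, and `I` for `cls`. -/
abbrev dom (I : Type) : Srt → Type
  | .num => ℕ
  | .cls => I

open Classical in
/-- The pre-model with domains `ℕ` and `I`, in which the element `i` of `I` stands for the function
`U i`, equality is interpreted by `E` and `E'` and `N` by the family `Pfam`. -/
noncomputable def arithModel (I : Type) (U : I → ℕ → Set PT)
    (c : (n : ℕ) → (P : Fml Empty) → P.Bdd (n + 1) → (Fin n → ℕ) → I) : PreModel where
  D := dom I
  zero := (0 : ℕ)
  succ := fun a : ℕ => (a + 1 : ℕ)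
  pred := fun a : ℕ => (a - 1 : ℕ)
  add := fun a b : ℕ => (a + b : ℕ)
  mul := fun a b : ℕ => (a * b : ℕ)
  comp := c
  eq := fun a b : ℕ => if a = b then E else E'
  null := fun _ => SN
  nat := fun a : ℕ => Pfam a
  mem := fun (a : ℕ) (i : I) => U i a

/-- The function `n ↦ ⟦P⟧_{φ, n/x}`, where `x` is variable `0` and `P` is without `∈`.  Such
a denotation does not involve the class domain (quantifiers of sort `cls` are vacuous), so it can be
computed in a pre-model with a one-point class domain. -/
noncomputable def defFun (P : Fml Empty) (φ : ℕ → ℕ) (n : ℕ) : Set PT :=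
  (arithModel Unit (fun _ _ => SN) (fun _ _ _ _ => ())).den₀
    (Env.push (fun | .num => φ | .cls => fun _ => ()) .num n) P

/-- The set `M_κ`: definable functions, constant functions with value `C_σ`, and the functions
`k ↦ C_k^{σ₀, σS}`. -/
def MKset : Set (ℕ → Set PT) :=
  {f | ∃ (P : Fml Empty) (φ : ℕ → ℕ), f = defFun P φ} ∪
  {f | ∃ q ∈ SN, f = fun _ => Csingle q} ∪
  {f | ∃ σ₀ σS : PT, f = Cfam σ₀ σS Pfam}

/-- `M_κ` as a type. -/
abbrev MK : Type := ↥MKset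

/-- The denotation of `f_P` sends `b₁, …, bₙ` to the function `k ↦ ⟦P⟧_{k/x, b₁/y₁, …, bₙ/yₙ}`. -/
noncomputable def compMK (n : ℕ) (P : Fml Empty) (_ : P.Bdd (n + 1)) (b : Fin n → ℕ) : MK :=
  ⟨defFun P (pad 0 b), Or.inl (Or.inl ⟨P, pad 0 b, rfl⟩)⟩

/-- The pre-model, with class domain `M_κ`. -/
noncomputable def theModel : PreModel := arithModel MK Subtype.val compMK

/-- The variant in which `M_κ` is replaced by `ℕ` by means of an enumeration `U` of `M_κ`. -/
noncomputable def indexedModel (U : ℕ → MK) (hU : Function.Surjective U) : PreModel :=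
  arithModel ℕ (fun m => (U m).val) (fun n P h b => Function.surjInv hU (compMK n P h b))

end HAMod

open HAMod

/-! The argument has two halves. The general half is adequacy (`Proves.mem_den`). Every proposition
denotes a reducibility candidate, and congruent propositions have the same denotation. Hence each
proof-term, after substitution of reducible proof-terms for its proof variables, lies in the
denotation of what it proves. Variables lie in every candidate, so the identity substitution gives
strong normalization.

The special half checks that the rewrite rules preserve denotations, and only the rules for equality
and `N` need work. Implication and universal quantification are first recast by elimination: `p`
lies in the denotation iff all its applications to admissible arguments lie in the right candidates
(`mem_sImp_iff`, `mem_sAll_iff`).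

For `N`, the sets `Cfam a b P n` form the least family of candidates that contains `a` at `0` and is
closed under the step function `b`. If `a` and `b` satisfy the premises of induction for some `f` in
`M_κ`, they form a Peano pair and the family lies inside `f`. Conversely, the family for `Pfam` is
itself a member of `M_κ`. So the right-hand side of the rule denotes `Phi Pfam`. As `P` grows, these
families grow and the Peano pairs become fewer, so `Phi` is monotone and has a least fixed point by
the Knaster–Tarski argument (`Phi_Pfam`).

For equality with `n = m`, the constant function `Csingle q` is the tightest test, since every
candidate containing `q` includes `Csingle q`. If `n ≠ m`, `M_κ` must contain a function with `q` in
its value at `n` and with value inside `botbot` at `m`. This is `exists_Cfam_separating`. For `n = k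
+ 1` the step function uses its proof of `N(j)` as an iterator: it takes `j` first projections of an
identity buried under `k` pairs and applies the result to `q`. Only for `j = k` is the identity
exposed. Numerals, that is, explicit inhabitants of `Pfam k`, ensure that `q` is really reached.

Finally, a proposition without `∈` depends on finitely many numerical variables and not on the class
domain (`Fml.exists_den₀_congr`). This removes the apparent circularity of `M_κ`, validates
comprehension, and gives countability. -/

namespace HAMod

/-! ## Substitution -/

section Push

variable {D : Srt → Type}

@[simp] theorem Env.push_zero (φ : Env D) (s : Srt) (d : D s) : φ.push s d s 0 = d := by
  simp [Env.push]

@[simp] theorem Env.push_succ (φ : Env D) (s : Srt) (d : D s) (n : ℕ) :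
    φ.push s d s (n + 1) = φ s n := by
  simp [Env.push]

theorem Env.push_of_ne (φ : Env D) {s s' : Srt} (d : D s) (h : s' ≠ s) :
    φ.push s d s' = φ s' := by
  simp [Env.push, h]

theorem Env.eq_push {φ ψ : Env D} {s : Srt} {d : D s} (h0 : ψ s 0 = d)
    (hS : ∀ n, ψ s (n + 1) = φ s n) (hne : ∀ s', s' ≠ s → ∀ n, ψ s' n = φ s' n) :
    ψ = φ.push s d := by
  funext s' n
  by_cases h : s' = s
  · subst h
    cases n <;> simp [h0, hS]
  · rw [hne s' h, Env.push_of_ne φ d h]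

end Push

@[simp] theorem Tm.subst_var (σ : Env Tm) (s : Srt) (n : ℕ) :
    Tm.subst σ s (Tm.var s n) = σ s n := by
  cases s <;> rfl

/-- Composition of substitutions: first `σ`, then `τ`. -/
def Env.comp (σ τ : Env Tm) : Env Tm := fun s n => Tm.subst τ s (σ s n)

theorem ITm.subst_subst (σ τ : Env Tm) (a : ITm) :
    (a.subst σ).subst τ = a.subst (σ.comp τ) := by
  induction a <;> simp_all [ITm.subst, Tm.subst, Env.comp]

theorem Tm.subst_subst (σ τ : Env Tm) (s : Srt) (t : Tm s) :
    Tm.subst τ s (Tm.subst σ s t) = Tm.subst (σ.comp τ) s t := by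
  cases s with
  | num => exact ITm.subst_subst σ τ t
  | cls =>
    cases t with
    | var => rfl
    | comp => simp [Tm.subst, KTm.subst, ITm.subst_subst]

theorem ITm.subst_id (a : ITm) : a.subst Tm.var = a := by
  induction a <;> simp_all [ITm.subst, Tm.var]

@[simp] theorem Tm.subst_id (s : Srt) (t : Tm s) : Tm.subst Tm.var s t = t := by
  cases s with
  | num => exact ITm.subst_id t
  | cls =>
    cases t with
    | var => rfl
    | comp => simp [Tm.subst, KTm.subst, ITm.subst_id]

theorem Env.comp_wk_push (σ : Env Tm) (s : Srt) (t : Tm s) : (wk s).comp (σ.push s t) = σ := by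
  funext s' n
  by_cases h : s' = s
  · subst h
    simp [Env.comp, wk]
  · simp [Env.comp, wk, h, Env.push_of_ne]

/-- The common source of the laws for substitution under a binder: taking `τ.push s t` to be `up s
τ` gives `comp_up_up`, and taking it to be `inst s t` gives `comp_up_inst`. -/
theorem Env.comp_up_push (σ τ : Env Tm) (s : Srt) (t : Tm s) :
    (up s σ).comp (τ.push s t) = (σ.comp τ).push s t := by
  apply Env.eq_push
  · simp [Env.comp, up]
  · intro n
    simp [Env.comp, up, Tm.subst_subst, Env.comp_wk_push]
  · intro s' h n
    simp [Env.comp, up, Tm.subst_subst, Env.comp_wk_push, Env.push_of_ne, h]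

theorem Env.comp_up_up (σ τ : Env Tm) (s : Srt) : (up s σ).comp (up s τ) = up s (σ.comp τ) := by
  rw [up.eq_def s τ, Env.comp_up_push, up]
  congr 1
  funext s' n
  exact (Tm.subst_subst _ _ _ _).symm

theorem Env.comp_wk_up (σ : Env Tm) (s : Srt) : (wk s).comp (up s σ) = σ.comp (wk s) :=
  Env.comp_wk_push _ _ _

@[simp] theorem up_id (s : Srt) : up s Tm.var = Tm.var := by
  symm
  apply Env.eq_push
  · rfl
  · intro n
    simp [wk]
  · intro s' h n
    simp [wk, h]

@[simp] theorem Env.comp_id (σ : Env Tm) : σ.comp Tm.var = σ := by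
  funext s n
  simp [Env.comp]

theorem Env.comp_up_inst (σ : Env Tm) (s : Srt) (t : Tm s) :
    (up s σ).comp (inst s t) = σ.push s t := by
  rw [inst, Env.comp_up_push, Env.comp_id]

theorem Env.comp_inst (σ : Env Tm) (s : Srt) (t : Tm s) :
    (inst s t).comp σ = σ.push s (Tm.subst σ s t) := by
  apply Env.eq_push
  · simp [Env.comp, inst]
  · intro n
    simp [Env.comp, inst]
  · intro s' h n
    simp [Env.comp, inst, Env.push_of_ne, h]

/-! ### Commutation laws for the three operations on proof-terms: term substitution, renaming, proof
substitution. -/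

theorem PT.tsubst_tsubst (p : PT) (σ τ : Env Tm) :
    (p.tsubst σ).tsubst τ = p.tsubst (σ.comp τ) := by
  induction p generalizing σ τ <;> simp_all [PT.tsubst, Env.comp_up_up, Tm.subst_subst]

@[simp] theorem PT.tsubst_id (p : PT) : p.tsubst Tm.var = p := by
  induction p <;> simp_all [PT.tsubst]

theorem PT.tsubst_ren (p : PT) (ξ : ℕ → ℕ) (σ : Env Tm) :
    (p.ren ξ).tsubst σ = (p.tsubst σ).ren ξ := by
  induction p generalizing ξ σ <;> simp_all [PT.tsubst, PT.ren]

theorem liftRen_comp (ξ ζ : ℕ → ℕ) : liftRen ζ ∘ liftRen ξ = liftRen (ζ ∘ ξ) := by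
  funext n
  cases n <;> rfl

theorem PT.ren_ren (p : PT) (ξ ζ : ℕ → ℕ) : (p.ren ξ).ren ζ = p.ren (ζ ∘ ξ) := by
  induction p generalizing ξ ζ <;> simp_all [PT.ren, liftRen_comp]

theorem PT.upP_comp_liftRen (θ : ℕ → PT) (ξ : ℕ → ℕ) : upP θ ∘ liftRen ξ = upP (θ ∘ ξ) := by
  funext n
  cases n <;> rfl

theorem PT.upT_comp (s : Srt) (θ : ℕ → PT) (ξ : ℕ → ℕ) : upT s θ ∘ ξ = upT s (θ ∘ ξ) := rfl

theorem PT.subst_ren (p : PT) (ξ : ℕ → ℕ) (θ : ℕ → PT) :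
    (p.ren ξ).subst θ = p.subst (θ ∘ ξ) := by
  induction p generalizing ξ θ <;>
    simp_all [PT.subst, PT.ren, PT.upP_comp_liftRen, PT.upT_comp]

theorem PT.upP_ren (θ : ℕ → PT) (ξ : ℕ → ℕ) :
    (fun n => (upP θ n).ren (liftRen ξ)) = upP (fun n => (θ n).ren ξ) := by
  funext n
  cases n with
  | zero => rfl
  | succ n =>
    simp only [upP, PT.ren_ren]
    rfl

theorem PT.upT_ren (s : Srt) (θ : ℕ → PT) (ξ : ℕ → ℕ) :
    (fun n => (upT s θ n).ren ξ) = upT s (fun n => (θ n).ren ξ) := by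
  funext n
  simp [upT, PT.tsubst_ren]

theorem PT.ren_subst (p : PT) (θ : ℕ → PT) (ξ : ℕ → ℕ) :
    (p.subst θ).ren ξ = p.subst (fun n => (θ n).ren ξ) := by
  induction p generalizing ξ θ <;>
    simp_all [PT.subst, PT.ren, PT.upP_ren, PT.upT_ren]

theorem PT.upP_tsubst (θ : ℕ → PT) (σ : Env Tm) :
    (fun n => (upP θ n).tsubst σ) = upP (fun n => (θ n).tsubst σ) := by
  funext n
  cases n with
  | zero => rfl
  | succ n => simp [upP, PT.tsubst_ren]

theorem PT.upT_tsubst (s : Srt) (θ : ℕ → PT) (σ : Env Tm) :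
    (fun n => (upT s θ n).tsubst (up s σ)) = upT s (fun n => (θ n).tsubst σ) := by
  funext n
  simp [upT, PT.tsubst_tsubst, Env.comp_wk_up]

theorem PT.tsubst_subst (p : PT) (θ : ℕ → PT) (σ : Env Tm) :
    (p.subst θ).tsubst σ = (p.tsubst σ).subst (fun n => (θ n).tsubst σ) := by
  induction p generalizing θ σ <;>
    simp_all [PT.subst, PT.tsubst, PT.upP_tsubst, PT.upT_tsubst]

theorem PT.upP_subst (θ η : ℕ → PT) :
    (fun n => (upP θ n).subst (upP η)) = upP (fun n => (θ n).subst η) := by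
  funext n
  cases n with
  | zero => rfl
  | succ n =>
    simp only [upP, PT.subst_ren, PT.ren_subst]
    rfl

theorem PT.upT_subst (s : Srt) (θ η : ℕ → PT) :
    (fun n => (upT s θ n).subst (upT s η)) = upT s (fun n => (θ n).subst η) := by
  funext n
  simp only [upT, PT.tsubst_subst]
  rfl

/-- Under binders this needs that lifting commutes with composition. That in turn rests on the laws
for renaming (proof binders) and for term substitution (term binders), which is why those come
before. -/
theorem PT.subst_subst (p : PT) (θ η : ℕ → PT) :
    (p.subst θ).subst η = p.subst (fun n => (θ n).subst η) := by
  induction p generalizing θ η <;>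
    simp_all [PT.subst, PT.upP_subst, PT.upT_subst]

@[simp] theorem PT.upP_id : upP PT.var = PT.var := by
  funext n
  cases n <;> rfl

@[simp] theorem PT.upT_id (s : Srt) : upT s PT.var = PT.var := rfl

@[simp] theorem PT.subst_id (p : PT) : p.subst PT.var = p := by
  induction p <;> simp_all [PT.subst]

/-- The sequence of proof-terms with first entry `q`, followed by `θ`. -/
def PT.cons (q : PT) (θ : ℕ → PT) : ℕ → PT := fun n => Nat.casesOn n q θ

theorem PT.inst0_eq (p q : PT) : p.inst0 q = p.subst (PT.cons q PT.var) := rfl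

theorem PT.ren_subst_cons (p q : PT) (θ : ℕ → PT) :
    (p.ren Nat.succ).subst (PT.cons q θ) = p.subst θ := by
  rw [PT.subst_ren]
  rfl

theorem PT.upP_subst_cons (θ η : ℕ → PT) (q : PT) :
    (fun n => (upP θ n).subst (PT.cons q η)) = PT.cons q (fun n => (θ n).subst η) := by
  funext n
  cases n with
  | zero => rfl
  | succ n => exact PT.ren_subst_cons _ _ _

/-- In adequacy, contracting a redex whose abstraction has undergone `θ` amounts to extending `θ` by
the argument. -/
theorem PT.subst_upP_inst0 (p q : PT) (θ : ℕ → PT) :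
    (p.subst (upP θ)).inst0 q = p.subst (PT.cons q θ) := by
  rw [PT.inst0_eq, PT.subst_subst, PT.upP_subst_cons]
  simp

theorem PT.cons_subst (q : PT) (θ η : ℕ → PT) :
    (fun n => (PT.cons q θ n).subst η) = PT.cons (q.subst η) (fun n => (θ n).subst η) := by
  funext n
  cases n <;> rfl

theorem PT.inst0_subst (p q : PT) (θ : ℕ → PT) :
    (p.inst0 q).subst θ = (p.subst (upP θ)).inst0 (q.subst θ) := by
  rw [PT.subst_upP_inst0, PT.inst0_eq, PT.subst_subst, PT.cons_subst]
  rfl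

theorem PT.inst0_tsubst (p q : PT) (σ : Env Tm) :
    (p.inst0 q).tsubst σ = (p.tsubst σ).inst0 (q.tsubst σ) := by
  rw [PT.inst0_eq, PT.tsubst_subst, PT.inst0_eq]
  congr 1
  funext n
  cases n <;> rfl

theorem PT.tinst0_tsubst (p : PT) (s : Srt) (t : Tm s) (σ : Env Tm) :
    (p.tinst0 s t).tsubst σ = (p.tsubst (up s σ)).tinst0 s (Tm.subst σ s t) := by
  simp [PT.tinst0, PT.tsubst_tsubst, Env.comp_inst, Env.comp_up_inst]

theorem PT.upT_inst (s : Srt) (t : Tm s) (θ : ℕ → PT) :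
    (fun n => (upT s θ n).tsubst (inst s t)) = θ := by
  funext n
  simp [upT, PT.tsubst_tsubst, inst, Env.comp_wk_push]

theorem PT.subst_upT_tinst0 (p : PT) (s : Srt) (t : Tm s) (θ : ℕ → PT) :
    (p.subst (upT s θ)).tinst0 s t = (p.tinst0 s t).subst θ := by
  rw [PT.tinst0, PT.tsubst_subst, PT.upT_inst]
  rfl

theorem PT.subst_upP_upT_tinst0 (p : PT) (s : Srt) (t : Tm s) (θ : ℕ → PT) :
    (p.subst (upP (upT s θ))).tinst0 s t = (p.tinst0 s t).subst (upP θ) := by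
  rw [PT.tinst0, PT.tsubst_subst, PT.upP_tsubst, PT.upT_inst]
  rfl

theorem PT.tsubst_up_tinst0 (p : PT) (s : Srt) (t : Tm s) (σ : Env Tm) :
    (p.tsubst (up s σ)).tinst0 s t = p.tsubst (σ.push s t) := by
  rw [PT.tinst0, PT.tsubst_tsubst, Env.comp_up_inst]

/-! ## Reduction and substitution -/

theorem Step.tsubst {p p' : PT} (h : Step p p') (σ : Env Tm) :
    Step (p.tsubst σ) (p'.tsubst σ) := by
  induction h generalizing σ with
  | beta p q => rw [PT.inst0_tsubst]; exact .beta _ _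
  | tbeta s p t => rw [PT.tinst0_tsubst]; exact .tbeta _ _ _
  | case_inl p q r => rw [PT.inst0_tsubst]; exact .case_inl _ _ _
  | case_inr p q r => rw [PT.inst0_tsubst]; exact .case_inr _ _ _
  | tcase_tpair s t p q =>
    rw [PT.inst0_tsubst, PT.tinst0_tsubst]; exact .tcase_tpair _ _ _ _
  | _ => constructor <;> solve_by_elim

theorem Step.subst {p p' : PT} (h : Step p p') (θ : ℕ → PT) :
    Step (p.subst θ) (p'.subst θ) := by
  induction h generalizing θ with
  | beta p q => rw [PT.inst0_subst]; exact .beta _ _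
  | tbeta s p t => rw [← PT.subst_upT_tinst0]; exact .tbeta _ _ _
  | case_inl p q r => rw [PT.inst0_subst]; exact .case_inl _ _ _
  | case_inr p q r => rw [PT.inst0_subst]; exact .case_inr _ _ _
  | tcase_tpair s t p q =>
    rw [PT.inst0_subst, ← PT.subst_upP_upT_tinst0]; exact .tcase_tpair _ _ _ _
  | _ => constructor <;> solve_by_elim

theorem Red.tsubst {p p' : PT} (h : Red p p') (σ : Env Tm) : Red (p.tsubst σ) (p'.tsubst σ) :=
  Relation.ReflTransGen.lift (fun p => PT.tsubst p σ) (fun _ _ h' => Step.tsubst h' σ) _ _ h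

theorem Red.subst {p p' : PT} (h : Red p p') (θ : ℕ → PT) : Red (p.subst θ) (p'.subst θ) :=
  Relation.ReflTransGen.lift (fun p => PT.subst p θ) (fun _ _ h' => Step.subst h' θ) _ _ h

/-! ## Strong normalization -/

theorem Red.lift {f : PT → PT} (hf : ∀ a b, Step a b → Step (f a) (f b)) {p p' : PT}
    (h : Red p p') : Red (f p) (f p') :=
  Relation.ReflTransGen.lift f hf _ _ h

theorem SN.intro {p : PT} (h : ∀ p', Step p p' → p' ∈ SN) : p ∈ SN := Acc.intro p h

theorem SN.step {p p' : PT} (h : p ∈ SN) (hs : Step p p') : p' ∈ SN := Acc.inv h hs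

theorem SN.red {p p' : PT} (h : p ∈ SN) (hr : Red p p') : p' ∈ SN := by
  induction hr with
  | refl => exact h
  | tail _ hs ih => exact SN.step ih hs

theorem SN.induction {motive : (p : PT) → p ∈ SN → Prop}
    (h : ∀ p (hp : p ∈ SN), (∀ p' (hs : Step p p'), motive p' (SN.step hp hs)) → motive p hp)
    {p : PT} (hp : p ∈ SN) : motive p hp := by
  induction hp with
  | intro p hp ih => exact h p (Acc.intro p hp) ih

/-- An infinite reduction from `p` would be carried by `f` to one from `f p`. Applied to contexts
and to substitutions. -/
theorem SN.of_map {f : PT → PT} (hf : ∀ a b, Step a b → Step (f a) (f b)) {p : PT}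
    (h : f p ∈ SN) : p ∈ SN := by
  generalize hq : f p = q at h
  induction h using SN.induction generalizing p with
  | h q _ ih =>
    subst hq
    exact SN.intro fun p' hs => ih _ (hf _ _ hs) rfl

theorem SN.of_subst {p : PT} {θ : ℕ → PT} (h : p.subst θ ∈ SN) : p ∈ SN :=
  SN.of_map (f := fun p => p.subst θ) (fun _ _ hs => hs.subst θ) h

theorem SN.of_tsubst {p : PT} {σ : Env Tm} (h : p.tsubst σ ∈ SN) : p ∈ SN :=
  SN.of_map (f := fun p => p.tsubst σ) (fun _ _ hs => hs.tsubst σ) h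

/-- For unary introductions: every step from `f p` takes place inside `p`. -/
theorem SN.map {f : PT → PT} (hf : ∀ a v, Step (f a) v → ∃ b, v = f b ∧ Step a b) {p : PT}
    (h : p ∈ SN) : f p ∈ SN := by
  induction h using SN.induction with
  | h p _ ih =>
    refine SN.intro fun v hs => ?_
    obtain ⟨b, rfl, hb⟩ := hf _ _ hs
    exact ih b hb

theorem Red.map_inv {f : PT → PT} (hf : ∀ a v, Step (f a) v → ∃ b, v = f b ∧ Step a b) {p v : PT}
    (h : Red (f p) v) : ∃ b, v = f b ∧ Red p b := by
  induction h with
  | refl => exact ⟨p, rfl, .refl⟩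
  | tail _ hs ih =>
    obtain ⟨b, rfl, hb⟩ := ih
    obtain ⟨c, rfl, hc⟩ := hf _ _ hs
    exact ⟨c, rfl, hb.tail hc⟩

theorem Step.lam_inv (a v : PT) (h : Step (.lam a) v) : ∃ b, v = .lam b ∧ Step a b := by
  cases h; exact ⟨_, rfl, by assumption⟩

theorem Step.inl_inv (a v : PT) (h : Step (.inl a) v) : ∃ b, v = .inl b ∧ Step a b := by
  cases h; exact ⟨_, rfl, by assumption⟩

theorem Step.inr_inv (a v : PT) (h : Step (.inr a) v) : ∃ b, v = .inr b ∧ Step a b := by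
  cases h; exact ⟨_, rfl, by assumption⟩

theorem Step.tlam_inv (s : Srt) (a v : PT) (h : Step (.tlam s a) v) :
    ∃ b, v = .tlam s b ∧ Step a b := by
  cases h; exact ⟨_, rfl, by assumption⟩

theorem Step.tpair_inv (s : Srt) (t : Tm s) (a v : PT) (h : Step (.tpair s t a) v) :
    ∃ b, v = .tpair s t b ∧ Step a b := by
  cases h; exact ⟨_, rfl, by assumption⟩

theorem Red.pair_inv {p q v : PT} (h : Red (.pair p q) v) :
    ∃ p' q', v = .pair p' q' ∧ Red p p' ∧ Red q q' := by
  induction h with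
  | refl => exact ⟨p, q, rfl, .refl, .refl⟩
  | tail _ hs ih =>
    obtain ⟨a, b, rfl, ha, hb⟩ := ih
    cases hs with
    | pair_left _ h => exact ⟨_, _, rfl, ha.tail h, hb⟩
    | pair_right _ h => exact ⟨_, _, rfl, ha, hb.tail h⟩

theorem SN.pair {p q : PT} (hp : p ∈ SN) (hq : q ∈ SN) : PT.pair p q ∈ SN := by
  induction hp using SN.induction generalizing q with
  | h p hp ihp =>
    induction hq using SN.induction with
    | h q hq ihq =>
      refine SN.intro fun v hs => ?_
      cases hs with
      | pair_left _ h => exact ihp _ h hq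
      | pair_right _ h => exact ihq _ h

theorem SN.var (n : ℕ) : PT.var n ∈ SN := SN.intro fun _ h => nomatch h

theorem SN.star : PT.star ∈ SN := SN.intro fun _ h => nomatch h

theorem SN.of_app_left {p q : PT} (h : PT.app p q ∈ SN) : p ∈ SN :=
  SN.of_map (f := fun p => PT.app p q) (fun _ _ hs => hs.app_left q) h

theorem SN.of_tapp {s : Srt} {p : PT} {t : Tm s} (h : PT.tapp s p t ∈ SN) : p ∈ SN :=
  SN.of_map (f := fun p => PT.tapp s p t) (fun _ _ hs => hs.tapp s t) h

/-! ## Reducibility candidates -/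

theorem IsCR.step {R : Set PT} (hR : IsCR R) {p p' : PT} (h : p ∈ R) (hs : Step p p') : p' ∈ R :=
  hR.red p h p' (.single hs)

theorem IsCR.var {R : Set PT} (hR : IsCR R) (n : ℕ) : PT.var n ∈ R :=
  hR.neutral _ trivial fun _ h => nomatch h

/-- Non-empty sets of strongly normalizable proof-terms that are closed under reduction. -/
structure IsStable (B : Set PT) : Prop where
  sn : ∀ p ∈ B, p ∈ SN
  red : ∀ p ∈ B, ∀ p', Red p p' → p' ∈ B
  nonempty : B.Nonempty

theorem IsCR.isStable {R : Set PT} (hR : IsCR R) : IsStable R :=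
  ⟨hR.sn, hR.red, _, hR.var 0⟩

/-- Allows an implication to be used whose only admissible arguments are the reducts of one fixed
proof-term. This set need not be a candidate, which is why stability is isolated as a weaker notion.
-/
theorem isStable_reducts {p : PT} (hp : p ∈ SN) : IsStable {p' | Red p p'} :=
  ⟨fun _ h => SN.red hp h, fun _ h _ h' => Relation.ReflTransGen.trans h h', p, .refl⟩

/-- A condition on all reducts of a strongly normalizable proof-term, trivial for neutral reducts,
defines a candidate. -/
theorem isCR_of_iff {R : Set PT} {T : PT → Prop} (hT : ∀ p : PT, p.Neutral → T p)
    (hR : ∀ p, p ∈ R ↔ p ∈ SN ∧ ∀ v, Red p v → T v) : IsCR R where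
  sn p hp := ((hR p).1 hp).1
  red p hp p' hr := (hR p').2 ⟨SN.red ((hR p).1 hp).1 hr, fun v hv => ((hR p).1 hp).2 v (hr.trans hv)⟩
  neutral p hp h := by
    refine (hR p).2 ⟨SN.intro fun p' hs => ((hR p').1 (h p' hs)).1, fun v hv => ?_⟩
    rcases Relation.ReflTransGen.cases_head hv with rfl | ⟨p', hs, hr⟩
    · exact hT _ hp
    · exact ((hR p').1 (h p' hs)).2 v hr

theorem isCR_SN : IsCR SN := isCR_of_iff (T := fun _ => True) (by simp) (by simp)

/-- The interpretation of implication. -/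
def sImp (B C : Set PT) : Set PT :=
  {p | p ∈ SN ∧ ∀ p', Red p (.lam p') → ∀ q ∈ B, p'.inst0 q ∈ C}

/-- The interpretation of conjunction. -/
def sAnd (B C : Set PT) : Set PT :=
  {p | p ∈ SN ∧ ∀ p₁ p₂, Red p (.pair p₁ p₂) → p₁ ∈ B ∧ p₂ ∈ C}

/-- The interpretation of disjunction. -/
def sOr (B C : Set PT) : Set PT :=
  {p | p ∈ SN ∧ (∀ p₁, Red p (.inl p₁) → p₁ ∈ B) ∧ (∀ p₂, Red p (.inr p₂) → p₂ ∈ C)}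

/-- The interpretation of universal quantification. -/
def sAll (s : Srt) {X : Type} (F : X → Set PT) : Set PT :=
  {p | p ∈ SN ∧ ∀ p', Red p (.tlam s p') → ∀ (x : X) (t : Tm s), p'.tinst0 s t ∈ F x}

/-- The interpretation of existential quantification. -/
def sEx (s : Srt) {X : Type} (F : X → Set PT) : Set PT :=
  {p | p ∈ SN ∧ ∀ (t : Tm s) (p' : PT), Red p (.tpair s t p') → ∃ x : X, p' ∈ F x}

theorem isCR_sImp (B C : Set PT) : IsCR (sImp B C) :=
  isCR_of_iff (T := fun v => ∀ p', v = .lam p' → ∀ q ∈ B, p'.inst0 q ∈ C)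
    (by rintro _ h p' rfl; exact h.elim)
    fun p => and_congr_right fun _ => ⟨by rintro h _ hr p' rfl; exact h p' hr,
      fun h p' hr => h _ hr p' rfl⟩

theorem isCR_sAnd (B C : Set PT) : IsCR (sAnd B C) :=
  isCR_of_iff (T := fun v => ∀ p₁ p₂, v = .pair p₁ p₂ → p₁ ∈ B ∧ p₂ ∈ C)
    (by rintro _ h p₁ p₂ rfl; exact h.elim)
    fun p => and_congr_right fun _ => ⟨by rintro h _ hr p₁ p₂ rfl; exact h _ _ hr,
      fun h p₁ p₂ hr => h _ hr _ _ rfl⟩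

theorem isCR_sOr (B C : Set PT) : IsCR (sOr B C) :=
  isCR_of_iff (T := fun v => (∀ p₁, v = .inl p₁ → p₁ ∈ B) ∧ ∀ p₂, v = .inr p₂ → p₂ ∈ C)
    (fun _ h => ⟨by rintro _ rfl; exact h.elim, by rintro _ rfl; exact h.elim⟩)
    fun p => and_congr_right fun _ =>
      ⟨fun h v hr => ⟨by rintro _ rfl; exact h.1 _ hr, by rintro _ rfl; exact h.2 _ hr⟩,
        fun h => ⟨fun _ hr => (h _ hr).1 _ rfl, fun _ hr => (h _ hr).2 _ rfl⟩⟩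

theorem isCR_sAll (s : Srt) {X : Type} (F : X → Set PT) : IsCR (sAll s F) :=
  isCR_of_iff (T := fun v => ∀ p', v = .tlam s p' → ∀ (x : X) (t : Tm s), p'.tinst0 s t ∈ F x)
    (by rintro _ h p' rfl; exact h.elim)
    fun p => and_congr_right fun _ => ⟨by rintro h _ hr p' rfl; exact h p' hr,
      fun h p' hr => h _ hr p' rfl⟩

theorem isCR_sEx (s : Srt) {X : Type} (F : X → Set PT) : IsCR (sEx s F) :=
  isCR_of_iff (T := fun v => ∀ t p', v = .tpair s t p' → ∃ x : X, p' ∈ F x)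
    (by rintro _ h t p' rfl; exact h.elim)
    fun p => and_congr_right fun _ => ⟨by rintro h _ hr t p' rfl; exact h t p' hr,
      fun h t p' hr => h _ hr t p' rfl⟩

/-! ### Introductions -/

/-- One instance of the body is strongly normalizable because `B` is non-empty, hence so is the
body. Reducts of the abstraction are abstractions of reducts of the body, and reduction commutes
with substitution. -/
theorem lam_mem_sImp {B C : Set PT} (hB : IsStable B) (hC : IsCR C) {p : PT}
    (h : ∀ q ∈ B, p.inst0 q ∈ C) : PT.lam p ∈ sImp B C := by
  obtain ⟨q₀, hq₀⟩ := hB.nonempty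
  have hp : p ∈ SN := SN.of_subst (hC.sn _ (h _ hq₀))
  refine ⟨SN.map Step.lam_inv hp, fun p' hr q hq => ?_⟩
  obtain ⟨b, hb, hr⟩ := Red.map_inv Step.lam_inv hr
  cases hb
  exact hC.red _ (h q hq) _ (hr.subst _)

theorem pair_mem_sAnd {B C : Set PT} (hB : IsCR B) (hC : IsCR C) {p q : PT}
    (hp : p ∈ B) (hq : q ∈ C) : PT.pair p q ∈ sAnd B C := by
  refine ⟨SN.pair (hB.sn _ hp) (hC.sn _ hq), fun p₁ p₂ hr => ?_⟩
  obtain ⟨p', q', h, hp', hq'⟩ := hr.pair_inv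
  cases h
  exact ⟨hB.red _ hp _ hp', hC.red _ hq _ hq'⟩

theorem inl_mem_sOr {B C : Set PT} (hB : IsCR B) {p : PT} (hp : p ∈ B) :
    PT.inl p ∈ sOr B C := by
  refine ⟨SN.map Step.inl_inv (hB.sn _ hp), fun v hr => ?_, fun v hr => ?_⟩
  · obtain ⟨b, hb, hr⟩ := Red.map_inv Step.inl_inv hr
    cases hb
    exact hB.red _ hp _ hr
  · obtain ⟨b, hb, hr⟩ := Red.map_inv Step.inl_inv hr
    cases hb

theorem inr_mem_sOr {B C : Set PT} (hC : IsCR C) {p : PT} (hp : p ∈ C) :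
    PT.inr p ∈ sOr B C := by
  refine ⟨SN.map Step.inr_inv (hC.sn _ hp), fun v hr => ?_, fun v hr => ?_⟩
  · obtain ⟨b, hb, hr⟩ := Red.map_inv Step.inr_inv hr
    cases hb
  · obtain ⟨b, hb, hr⟩ := Red.map_inv Step.inr_inv hr
    cases hb
    exact hC.red _ hp _ hr

theorem tlam_mem_sAll {s : Srt} {X : Type} [Nonempty X] {F : X → Set PT} (hF : ∀ x, IsCR (F x))
    {p : PT} (h : ∀ x t, p.tinst0 s t ∈ F x) : PT.tlam s p ∈ sAll s F := by
  have hp : p ∈ SN := SN.of_tsubst ((hF (Classical.arbitrary X)).sn _ (h _ (Tm.var s 0)))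
  refine ⟨SN.map (Step.tlam_inv s) hp, fun p' hr x t => ?_⟩
  obtain ⟨b, hb, hr⟩ := Red.map_inv (Step.tlam_inv s) hr
  cases hb
  exact (hF x).red _ (h x t) _ (hr.tsubst _)

theorem tpair_mem_sEx {s : Srt} {X : Type} {F : X → Set PT} (hF : ∀ x, IsCR (F x))
    {p : PT} (t : Tm s) (x : X) (h : p ∈ F x) : PT.tpair s t p ∈ sEx s F := by
  refine ⟨SN.map (Step.tpair_inv s t) ((hF x).sn _ h), fun t' p' hr => ?_⟩
  obtain ⟨b, hb, hr⟩ := Red.map_inv (Step.tpair_inv s t) hr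
  cases hb
  exact ⟨x, (hF x).red _ h _ hr⟩

/-! ### Eliminations -/

/-- An elimination is neutral, so only its one-step reducts matter. Inner steps are handled by
induction on the strong normalizability of the immediate subterms, the head step by the definition
of the connective. The other eliminations follow the same pattern. -/
theorem app_mem {B C : Set PT} (hB : IsStable B) (hC : IsCR C) {p q : PT} (hp : p ∈ sImp B C)
    (hq : q ∈ B) : PT.app p q ∈ C := by
  have hps := hp.1
  induction hps using SN.induction generalizing q with
  | h p _ ihp =>
    have hqs := hB.sn q hq
    induction hqs using SN.induction with
    | h q _ ihq =>
      refine hC.neutral _ trivial fun v hs => ?_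
      cases hs with
      | beta p q => exact hp.2 p .refl q hq
      | app_left _ h => exact ihp _ h ((isCR_sImp B C).step hp h) hq
      | app_right _ h => exact ihq _ h (hB.red _ hq _ (.single h))

theorem tapp_mem {s : Srt} {X : Type} {F : X → Set PT} {x : X} (hF : IsCR (F x)) {p : PT}
    (hp : p ∈ sAll s F) (t : Tm s) : PT.tapp s p t ∈ F x := by
  have hps := hp.1
  induction hps using SN.induction with
  | h p _ ihp =>
    refine hF.neutral _ trivial fun v hs => ?_
    cases hs with
    | tbeta s p t => exact hp.2 p .refl x t
    | tapp _ _ h => exact ihp _ h ((isCR_sAll s F).step hp h)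

theorem fst_mem {B C : Set PT} (hB : IsCR B) {p : PT} (hp : p ∈ sAnd B C) : PT.fst p ∈ B := by
  have hps := hp.1
  induction hps using SN.induction with
  | h p _ ihp =>
    refine hB.neutral _ trivial fun v hs => ?_
    cases hs with
    | fst_pair p q => exact (hp.2 _ _ .refl).1
    | fst h => exact ihp _ h ((isCR_sAnd B C).step hp h)

theorem snd_mem {B C : Set PT} (hC : IsCR C) {p : PT} (hp : p ∈ sAnd B C) : PT.snd p ∈ C := by
  have hps := hp.1
  induction hps using SN.induction with
  | h p _ ihp =>
    refine hC.neutral _ trivial fun v hs => ?_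
    cases hs with
    | snd_pair p q => exact (hp.2 _ _ .refl).2
    | snd h => exact ihp _ h ((isCR_sAnd B C).step hp h)

theorem abort_mem {C : Set PT} (hC : IsCR C) {p : PT} (hp : p ∈ SN) : PT.abort p ∈ C := by
  induction hp using SN.induction with
  | h p _ ihp =>
    refine hC.neutral _ trivial fun v hs => ?_
    cases hs with
    | abort h => exact ihp _ h

theorem case_mem {A B C : Set PT} (hA : IsCR A) (hB : IsCR B) (hC : IsCR C) {p q r : PT}
    (hp : p ∈ sOr A B) (hq : ∀ a ∈ A, q.inst0 a ∈ C) (hr : ∀ b ∈ B, r.inst0 b ∈ C) :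
    PT.case p q r ∈ C := by
  -- The branches have no membership hypothesis of their own; their instances at a variable show
  -- that they are strongly normalizable.
  have hqs : q ∈ SN := SN.of_subst (hC.sn _ (hq _ (hA.var 0)))
  have hrs : r ∈ SN := SN.of_subst (hC.sn _ (hr _ (hB.var 0)))
  have hps := hp.1
  induction hps using SN.induction generalizing q r with
  | h p _ ihp =>
    induction hqs using SN.induction generalizing r with
    | h q hqs ihq =>
      induction hrs using SN.induction with
      | h r hrs ihr =>
        refine hC.neutral _ trivial fun v hs => ?_
        cases hs with
        | case_inl p q r => exact hq _ (hp.2.1 _ .refl)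
        | case_inr p q r => exact hr _ (hp.2.2 _ .refl)
        | case_scrut _ _ h => exact ihp _ h ((isCR_sOr A B).step hp h) hq hr hqs hrs
        | case_left _ _ h => exact ihq _ h (fun a ha => hC.step (hq a ha) (h.subst _)) hr hrs
        | case_right _ _ h => exact ihr _ h (fun a ha => hC.step (hr a ha) (h.subst _))

theorem tcase_mem {s : Srt} {X : Type} [Nonempty X] {F : X → Set PT} (hF : ∀ x, IsCR (F x))
    {C : Set PT} (hC : IsCR C) {p q : PT} (hp : p ∈ sEx s F)
    (hq : ∀ t x, ∀ a ∈ F x, (q.tinst0 s t).inst0 a ∈ C) : PT.tcase s p q ∈ C := by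
  have hqs : q ∈ SN := SN.of_tsubst <| SN.of_subst <| hC.sn _ <|
    hq (Tm.var s 0) (Classical.arbitrary X) _ ((hF _).var 0)
  have hps := hp.1
  induction hps using SN.induction generalizing q with
  | h p _ ihp =>
    induction hqs using SN.induction with
    | h q hqs ihq =>
      refine hC.neutral _ trivial fun v hs => ?_
      cases hs with
      | tcase_tpair s t p q =>
        obtain ⟨x, hx⟩ := hp.2 t p .refl
        exact hq t x p hx
      | tcase_scrut _ _ h => exact ihp _ h ((isCR_sEx s F).step hp h) hq hqs
      | tcase_body _ _ h =>
        exact ihq _ h fun t x a ha => hC.step (hq t x a ha) ((h.tsubst _).subst _)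

/-- Backwards: if `p` reduces to an abstraction, then `app p q` reduces to the corresponding
instance of its body, and `C` is closed under reduction. -/
theorem mem_sImp_iff {B C : Set PT} (hB : IsStable B) (hC : IsCR C) {p : PT} :
    p ∈ sImp B C ↔ ∀ q ∈ B, PT.app p q ∈ C := by
  refine ⟨fun h q hq => app_mem hB hC h hq, fun h => ⟨?_, fun p' hr q hq => ?_⟩⟩
  · obtain ⟨q, hq⟩ := hB.nonempty
    exact SN.of_app_left (hC.sn _ (h q hq))
  · exact hC.red _ (h q hq) _ ((Red.lift (f := fun p => PT.app p q)
      (fun _ _ hs => hs.app_left q) hr).tail (.beta _ _))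

theorem mem_sAll_iff {s : Srt} {X : Type} [Nonempty X] {F : X → Set PT} (hF : ∀ x, IsCR (F x))
    {p : PT} : p ∈ sAll s F ↔ ∀ x t, PT.tapp s p t ∈ F x := by
  refine ⟨fun h x t => tapp_mem (hF x) h t, fun h => ⟨?_, fun p' hr x t => ?_⟩⟩
  · exact SN.of_tapp ((hF (Classical.arbitrary X)).sn _ (h _ (Tm.var s 0)))
  · exact (hF x).red _ (h x t) _ ((Red.lift (f := fun p => PT.tapp s p t)
      (fun _ _ hs => hs.tapp s t) hr).tail (.tbeta _ _ _))

/-! ## Denotations -/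

section Denotation

variable {M : PreModel}

/-- Denotation of the terms of each sort. -/
def Tm.den (M : PreModel) (φ : Env M.D) : (s : Srt) → Tm s → M.D s
  | .num, t => ITm.den M φ t
  | .cls, t => KTm.den M φ t

/-- The assignment `n ↦ ⟦σ n⟧_φ`. -/
def Env.den (φ : Env M.D) (σ : Env Tm) : Env M.D := fun s n => Tm.den M φ s (σ s n)

@[simp] theorem Tm.den_var (φ : Env M.D) (s : Srt) (n : ℕ) :
    Tm.den M φ s (Tm.var s n) = φ s n := by
  cases s <;> rfl

theorem ITm.den_subst (φ : Env M.D) (σ : Env Tm) (a : ITm) :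
    (a.subst σ).den M φ = a.den M (φ.den σ) := by
  induction a <;> simp_all [ITm.subst, ITm.den, Env.den, Tm.den]

theorem KTm.den_subst (φ : Env M.D) (σ : Env Tm) (c : KTm) :
    (c.subst σ).den M φ = c.den M (φ.den σ) := by
  cases c with
  | var => rfl
  | comp => simp [KTm.subst, KTm.den, ITm.den_subst]

theorem Tm.den_subst (φ : Env M.D) (σ : Env Tm) (s : Srt) (t : Tm s) :
    Tm.den M φ s (Tm.subst σ s t) = Tm.den M (φ.den σ) s t := by
  cases s with
  | num => exact ITm.den_subst φ σ t
  | cls => exact KTm.den_subst φ σ t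

theorem Env.den_wk (φ : Env M.D) (s : Srt) (X : M.D s) : (φ.push s X).den (wk s) = φ := by
  funext s' n
  by_cases h : s' = s
  · subst h
    simp [Env.den, wk]
  · simp [Env.den, wk, h, Env.push_of_ne]

theorem Env.den_up (φ : Env M.D) (s : Srt) (X : M.D s) (σ : Env Tm) :
    (φ.push s X).den (up s σ) = (φ.den σ).push s X := by
  apply Env.eq_push
  · simp [Env.den, up]
  · intro n
    simp [Env.den, up, Tm.den_subst, Env.den_wk]
  · intro s' h n
    simp [Env.den, up, Env.push_of_ne _ _ h, Tm.den_subst, Env.den_wk]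

theorem Env.den_inst (φ : Env M.D) (s : Srt) (t : Tm s) :
    φ.den (inst s t) = φ.push s (Tm.den M φ s t) := by
  apply Env.eq_push
  · simp [Env.den, inst]
  · intro n
    simp [Env.den, inst]
  · intro s' h n
    simp [Env.den, inst, Env.push_of_ne, h]

theorem Fml.denWith_substWith {K : Type} {k : Env Tm → K → KTm} {k' : Env M.D → K → M.D .cls}
    (hk : ∀ φ σ c, (k σ c).den M φ = k' (φ.den σ) c) (A : Fml K) (σ : Env Tm) (φ : Env M.D) :
    (A.substWith k σ).denWith M (KTm.den M) φ = A.denWith M k' (φ.den σ) := by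
  induction A generalizing σ φ with
  | all s A ih => simp [Fml.substWith, Fml.denWith, ih, Env.den_up]
  | ex s A ih => simp [Fml.substWith, Fml.denWith, ih, Env.den_up]
  | _ => simp_all [Fml.substWith, Fml.denWith, ITm.den_subst]

theorem PreModel.den_subst (A : Prp) (σ : Env Tm) (φ : Env M.D) :
    M.den φ (A.subst σ) = M.den (φ.den σ) A :=
  Fml.denWith_substWith (fun φ σ c => KTm.den_subst φ σ c) A σ φ

theorem PreModel.den_wk (A : Prp) (φ : Env M.D) (s : Srt) (X : M.D s) :
    M.den (φ.push s X) (A.subst (wk s)) = M.den φ A := by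
  rw [PreModel.den_subst, Env.den_wk]

theorem PreModel.den_inst (A : Prp) (φ : Env M.D) (s : Srt) (t : Tm s) :
    M.den φ (A.subst (inst s t)) = M.den (φ.push s (Tm.den M φ s t)) A := by
  rw [PreModel.den_subst, Env.den_inst]

/-- No induction is needed: each connective turns arbitrary sets of proof-terms into a candidate. -/
theorem PreModel.IsPreModel.isCR_denWith (hM : M.IsPreModel) {K : Type}
    (k : Env M.D → K → M.D .cls) (A : Fml K) (φ : Env M.D) : IsCR (A.denWith M k φ) := by
  cases A with
  | eq a b => exact hM.eq_cr _ _
  | null a => exact hM.null_cr _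
  | nat a => exact hM.nat_cr _
  | mem a c => exact hM.mem_cr _ _
  | top => exact isCR_SN
  | bot => exact isCR_SN
  | imp A B => exact isCR_sImp _ _
  | and A B => exact isCR_sAnd _ _
  | or A B => exact isCR_sOr _ _
  | all s A => exact isCR_sAll _ _
  | ex s A => exact isCR_sEx _ _

theorem PreModel.IsPreModel.isCR_den (hM : M.IsPreModel) (φ : Env M.D) (A : Prp) :
    IsCR (M.den φ A) :=
  hM.isCR_denWith _ A φ

/-! ## Adequacy -/

theorem PT.cons_mem {Γ : List Prp} {θ : ℕ → PT} {φ : Env M.D} {A : Prp} {a : PT}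
    (hΓ : ∀ n B, Γ[n]? = some B → θ n ∈ M.den φ B) (ha : a ∈ M.den φ A) (n : ℕ) (B : Prp)
    (h : (A :: Γ)[n]? = some B) : PT.cons a θ n ∈ M.den φ B := by
  cases n with
  | zero =>
    obtain rfl : A = B := by simpa using h
    exact ha
  | succ n => exact hΓ n B (by simpa using h)

theorem PreModel.mem_den_map_wk {Γ : List Prp} {θ : ℕ → PT} {φ : Env M.D}
    (hΓ : ∀ n B, Γ[n]? = some B → θ n ∈ M.den φ B) (s : Srt) (X : M.D s) (n : ℕ) (B : Prp)
    (h : (Γ.map (Prp.subst (wk s)))[n]? = some B) : θ n ∈ M.den (φ.push s X) B := by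
  rw [List.getElem?_map, Option.map_eq_some_iff] at h
  obtain ⟨A, hA, rfl⟩ := h
  rw [PreModel.den_wk]
  exact hΓ n A hA

/-- The term substitution `σ` and the assignment `φ` are unrelated, because the clause for `∀` lets
the term and the domain element vary independently. All of `φ`, `σ`, `θ` must vary in the induction,
since binders extend them. -/
theorem Proves.mem_den (hM : M.IsPreModel) (hC : M.ModelsCong) {Γ : List Prp} {p : PT} {A : Prp}
    (h : Proves Γ p A) (φ : Env M.D) (σ : Env Tm) (θ : ℕ → PT)
    (hΓ : ∀ n B, Γ[n]? = some B → θ n ∈ M.den φ B) :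
    (p.tsubst σ).subst θ ∈ M.den φ A := by
  have cr := hM.isCR_den
  induction h generalizing φ σ θ with
  | ax hn hAB => rw [← hC _ _ hAB φ]; exact hΓ _ _ hn
  | imp_intro e _ ih =>
    rw [hC _ _ e φ]
    refine lam_mem_sImp (cr _ _).isStable (cr _ _) fun q hq => ?_
    rw [PT.subst_upP_inst0]
    exact ih _ _ _ (PT.cons_mem hΓ hq)
  | imp_elim e _ _ ih₁ ih₂ =>
    have h₁ := ih₁ φ σ θ hΓ
    rw [hC _ _ e φ] at h₁
    exact app_mem (cr _ _).isStable (cr _ _) h₁ (ih₂ φ σ θ hΓ)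
  | and_intro e _ _ ih₁ ih₂ =>
    rw [hC _ _ e φ]
    exact pair_mem_sAnd (cr _ _) (cr _ _) (ih₁ φ σ θ hΓ) (ih₂ φ σ θ hΓ)
  | and_left e _ ih =>
    have h := ih φ σ θ hΓ
    rw [hC _ _ e φ] at h
    exact fst_mem (cr _ _) h
  | and_right e _ ih =>
    have h := ih φ σ θ hΓ
    rw [hC _ _ e φ] at h
    exact snd_mem (cr _ _) h
  | or_left e _ ih =>
    rw [hC _ _ e φ]
    exact inl_mem_sOr (cr _ _) (ih φ σ θ hΓ)
  | or_right e _ ih =>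
    rw [hC _ _ e φ]
    exact inr_mem_sOr (cr _ _) (ih φ σ θ hΓ)
  | or_elim e _ _ _ ih₁ ih₂ ih₃ =>
    have h := ih₁ φ σ θ hΓ
    rw [hC _ _ e φ] at h
    refine case_mem (cr _ _) (cr _ _) (cr _ _) h (fun a ha => ?_) fun b hb => ?_
    · rw [PT.subst_upP_inst0]
      exact ih₂ _ _ _ (PT.cons_mem hΓ ha)
    · rw [PT.subst_upP_inst0]
      exact ih₃ _ _ _ (PT.cons_mem hΓ hb)
  | top_intro e =>
    rw [hC _ _ e φ]
    exact SN.star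
  | bot_elim e _ ih => exact abort_mem (cr _ _) ((cr _ _).sn _ (ih φ σ θ hΓ))
  | @all_intro _ _ s _ _ e _ ih =>
    rw [hC _ _ e φ]
    have : Nonempty (M.D s) := ⟨φ s 0⟩
    refine tlam_mem_sAll (fun _ => cr _ _) fun X t => ?_
    rw [PT.subst_upT_tinst0, PT.tsubst_up_tinst0]
    exact ih _ _ _ (PreModel.mem_den_map_wk hΓ s X)
  | all_elim t e e' _ ih =>
    have h := ih φ σ θ hΓ
    rw [hC _ _ e φ] at h
    rw [hC _ _ e' φ, PreModel.den_inst]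
    exact tapp_mem (F := fun X => M.den (φ.push _ X) _) (cr _ _) h _
  | ex_intro t e e' _ ih =>
    have h := ih φ σ θ hΓ
    rw [hC _ _ e' φ, PreModel.den_inst] at h
    rw [hC _ _ e φ]
    exact tpair_mem_sEx (F := fun X => M.den (φ.push _ X) _) (fun _ => cr _ _) _ _ h
  | @ex_elim _ _ _ s _ _ _ e _ _ ih₁ ih₂ =>
    have h := ih₁ φ σ θ hΓ
    rw [hC _ _ e φ] at h
    have : Nonempty (M.D s) := ⟨φ s 0⟩
    refine tcase_mem (F := fun X => M.den (φ.push _ X) _) (fun _ => cr _ _) (cr _ _) h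
      fun t X a ha => ?_
    -- The conclusion does not depend on the witness, so it may be read, weakened, under the
    -- extended assignment, as the induction hypothesis requires.
    rw [PT.subst_upP_upT_tinst0, PT.tsubst_up_tinst0, PT.subst_upP_inst0,
      ← PreModel.den_wk _ φ s X]
    exact ih₂ _ _ _ (PT.cons_mem (PreModel.mem_den_map_wk hΓ s X) ha)

theorem Proves.mem_SN (hM : M.IsPreModel) (hC : M.ModelsCong) (φ : Env M.D) {Γ : List Prp}
    {p : PT} {A : Prp} (h : Proves Γ p A) : p ∈ SN := by
  have hp := h.mem_den hM hC φ Tm.var PT.var fun n B _ => (hM.isCR_den φ B).var n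
  rw [PT.tsubst_id, PT.subst_id] at hp
  exact (hM.isCR_den φ A).sn _ hp

end Denotation

/-! ## Generated candidates -/

/-- The separate condition of strong normalizability covers an empty index type. -/
theorem isCR_of_forall {ι : Type} {R : Set PT} {F : ι → Set PT} (hF : ∀ i, IsCR (F i))
    (hR : ∀ p, p ∈ R ↔ p ∈ SN ∧ ∀ i, p ∈ F i) : IsCR R where
  sn p hp := ((hR p).1 hp).1
  red p hp p' hr := (hR p').2
    ⟨SN.red ((hR p).1 hp).1 hr, fun i => (hF i).red _ (((hR p).1 hp).2 i) _ hr⟩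
  neutral p hp h := (hR p).2 ⟨SN.intro fun p' hs => ((hR p').1 (h p' hs)).1,
    fun i => (hF i).neutral p hp fun p' hs => ((hR p').1 (h p' hs)).2 i⟩

/-- A neutral `p` is not an abstraction, so `app p q` has no head redex and all its steps are inside
`p` or inside `q`. With its analogue for `tapp`, it makes `E`, `E'` and `Phi P n` candidates. -/
theorem isCR_preimage_app {C : Set PT} (hC : IsCR C) {q : PT} (hq : q ∈ SN) :
    IsCR {p | PT.app p q ∈ C} where
  sn p hp := SN.of_app_left (hC.sn _ hp)
  red p hp p' hr := hC.red _ hp _ (hr.lift (f := fun p => PT.app p q) fun _ _ h => h.app_left q)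
  neutral p hp h := by
    induction hq using SN.induction with
    | h q hq ih =>
      refine hC.neutral _ trivial fun v hs => ?_
      cases hs with
      | beta => exact hp.elim
      | app_left _ hs => exact h _ hs
      | app_right _ hs => exact ih _ hs fun p' hp' => hC.step (h p' hp') (hs.app_right p')

theorem isCR_preimage_tapp {C : Set PT} (hC : IsCR C) (s : Srt) (t : Tm s) :
    IsCR {p | PT.tapp s p t ∈ C} where
  sn p hp := SN.of_tapp (hC.sn _ hp)
  red p hp p' hr := hC.red _ hp _ (hr.lift (f := fun p => PT.tapp s p t) fun _ _ h => h.tapp s t)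
  neutral p hp h := by
    refine hC.neutral _ trivial fun v hs => ?_
    cases hs with
    | tbeta => exact hp.elim
    | tapp _ _ hs => exact h _ hs

theorem gen_subset {A R : Set PT} (hR : IsCR R) (h : A ⊆ R) : gen A ⊆ R := by
  intro p hp
  induction hp with
  | base hp => exact h hp
  | red _ hr ih => exact hR.red _ ih _ hr
  | neutral hn _ ih => exact hR.neutral _ hn ih

theorem isCR_gen {A : Set PT} (h : A ⊆ SN) : IsCR (gen A) :=
  ⟨gen_subset isCR_SN h, fun _ hp _ hr => Gen.red hp hr, fun _ hn h => Gen.neutral hn h⟩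

theorem isCR_botbot : IsCR botbot := isCR_gen (Set.empty_subset _)

theorem botbot_subset {R : Set PT} (hR : IsCR R) : botbot ⊆ R := gen_subset hR (Set.empty_subset _)

theorem isCR_Csingle {q : PT} (hq : q ∈ SN) : IsCR (Csingle q) :=
  isCR_gen (Set.singleton_subset_iff.2 hq)

theorem mem_Csingle (q : PT) : q ∈ Csingle q := Gen.base rfl

theorem Csingle_subset {R : Set PT} (hR : IsCR R) {q : PT} (hq : q ∈ R) : Csingle q ⊆ R :=
  gen_subset hR (Set.singleton_subset_iff.2 hq)

theorem isCR_E : IsCR E :=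
  isCR_of_forall (ι := Tm .cls × ↥SN)
    (F := fun i => {p | PT.app (.tapp .cls p i.1) i.2 ∈ Csingle i.2})
    (fun i => isCR_preimage_tapp (isCR_preimage_app (isCR_Csingle i.2.2) i.2.2) _ _)
    fun _ => and_congr_right fun _ => ⟨fun h i => h i.1 i.2 i.2.2, fun h t q hq => h (t, ⟨q, hq⟩)⟩

theorem isCR_E' : IsCR E' :=
  isCR_of_forall (ι := Tm .cls × ↥SN)
    (F := fun i => {p | PT.app (.tapp .cls p i.1) i.2 ∈ botbot})
    (fun i => isCR_preimage_tapp (isCR_preimage_app isCR_botbot i.2.2) _ _)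
    fun _ => and_congr_right fun _ => ⟨fun h i => h i.1 i.2 i.2.2, fun h t q hq => h (t, ⟨q, hq⟩)⟩

/-! ## The least fixed point -/

theorem isCR_Cfam (a b : PT) (P : ℕ → Set PT) (n : ℕ) : IsCR (Cfam a b P n) := by
  cases n with
  | zero => exact isCR_gen fun _ h => h.2
  | succ n => exact isCR_gen fun _ h => h.1

theorem mem_Cfam_zero {a b : PT} (P : ℕ → Set PT) (ha : a ∈ SN) : a ∈ Cfam a b P 0 :=
  Gen.base ⟨rfl, ha⟩

theorem mem_Cfam_succ {a b : PT} {P : ℕ → Set PT} {n : ℕ} {t : Tm .num} {r q : PT} (hr : r ∈ P n)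
    (hq : q ∈ Cfam a b P n) (h : PT.app (.app (.tapp .num b t) r) q ∈ SN) :
    PT.app (.app (.tapp .num b t) r) q ∈ Cfam a b P (n + 1) :=
  Gen.base ⟨h, t, r, hr, q, hq, rfl⟩

/-- Induction principle for the sets `C_n^{a, b, P}`. -/
theorem Cfam_subset {a b : PT} {P F : ℕ → Set PT} (hF : ∀ n, IsCR (F n))
    (h0 : a ∈ SN → a ∈ F 0)
    (hS : ∀ n (t : Tm .num), ∀ r ∈ P n, ∀ q ∈ Cfam a b P n, q ∈ F n →
      PT.app (.app (.tapp .num b t) r) q ∈ SN →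
      PT.app (.app (.tapp .num b t) r) q ∈ F (n + 1)) (n : ℕ) :
    Cfam a b P n ⊆ F n := by
  induction n with
  | zero =>
    refine gen_subset (hF 0) ?_
    rintro _ ⟨rfl, h⟩
    exact h0 h
  | succ n ih =>
    refine gen_subset (hF _) ?_
    rintro _ ⟨h, t, r, hr, q, hq, rfl⟩
    exact hS n t r hr q hq (ih hq) h

theorem Cfam_mono {P Q : ℕ → Set PT} (h : P ≤ Q) (a b : PT) (n : ℕ) :
    Cfam a b P n ⊆ Cfam a b Q n :=
  Cfam_subset (isCR_Cfam a b Q) (mem_Cfam_zero Q)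
    (fun n _ _ hr _ _ hq hs => mem_Cfam_succ (h n hr) hq hs) n

theorem IsPeano.anti {P Q : ℕ → Set PT} (h : P ≤ Q) {a b : PT} (hp : IsPeano Q a b) :
    IsPeano P a b :=
  ⟨hp.1, hp.2.1, fun t n r hr q hq => hp.2.2 t n r (h n hr) q (Cfam_mono h a b n hq)⟩

/-- A larger sequence enlarges the target sets and leaves fewer Peano pairs to test; both effects
enlarge `Phi`. -/
theorem Phi_mono {P Q : ℕ → Set PT} (h : P ≤ Q) : Phi P ≤ Phi Q := fun n _ hp =>
  ⟨hp.1, fun t a b hab => Cfam_mono h a b n (hp.2 t a b (hab.anti h))⟩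

theorem isCR_Phi (P : ℕ → Set PT) (n : ℕ) : IsCR (Phi P n) :=
  isCR_of_forall (ι := Tm .cls × {ab : PT × PT // IsPeano P ab.1 ab.2})
    (F := fun i => {p | PT.app (.app (.tapp .cls p i.1) i.2.1.1) i.2.1.2 ∈
      Cfam i.2.1.1 i.2.1.2 P n})
    (fun i => isCR_preimage_tapp (isCR_preimage_app
      (isCR_preimage_app (isCR_Cfam _ _ _ _) i.2.2.2.1) i.2.2.1) _ _)
    fun _ => and_congr_right fun _ => ⟨fun h i => h i.1 _ _ i.2.2,
      fun h t a b hab => h (t, ⟨(a, b), hab⟩)⟩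

theorem Pfam_le {Q : ℕ → Set PT} (hQ : ∀ n, IsCR (Q n)) (h : Phi Q ≤ Q) : Pfam ≤ Q :=
  fun _ _ hp => hp Q hQ h

theorem isCR_Pfam (n : ℕ) : IsCR (Pfam n) where
  sn _ hp := hp (fun _ => SN) (fun _ => isCR_SN) fun _ _ h => h.1
  red _ hp _ hr _ hQ h := (hQ n).red _ (hp _ hQ h) _ hr
  neutral p hp h _ hQ hQ' := (hQ n).neutral p hp fun p' hs => h p' hs _ hQ hQ'

theorem Phi_Pfam_le : Phi Pfam ≤ Pfam :=
  fun n _ hp _ hQ h => h n (Phi_mono (Pfam_le hQ h) n hp)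

theorem Phi_Pfam : Phi Pfam = Pfam :=
  le_antisymm Phi_Pfam_le (Pfam_le (isCR_Phi _) (Phi_mono Phi_Pfam_le))

theorem isLeast_Pfam : IsLeast {Q : ℕ → Set PT | (∀ n, IsCR (Q n)) ∧ Phi Q = Q} Pfam :=
  ⟨⟨isCR_Pfam, Phi_Pfam⟩, fun _ hQ => Pfam_le hQ.1 hQ.2.le⟩

/-! ## Separation of numbers by the sets `C_n` -/

/-- `λx λα λβ B` with `x` of sort `s`. -/
def PT.tlam₂ (s : Srt) (B : PT) : PT := .tlam s (.lam (.lam B))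

theorem PT.lam_inst0_inst0 (B r q : PT) :
    (B.subst (upP (PT.cons r PT.var))).inst0 q = B.subst (PT.cons q (PT.cons r PT.var)) :=
  PT.subst_upP_inst0 _ _ _

theorem Red.tlam₂ (s : Srt) (B : PT) (t : Tm s) (r q : PT) :
    Red (.app (.app (.tapp s (PT.tlam₂ s B) t) r) q)
      ((B.tinst0 s t).subst (PT.cons q (PT.cons r PT.var))) := by
  refine .head (((Step.tbeta s _ t).app_left r).app_left q) (.head ((Step.beta _ r).app_left q) ?_)
  rw [← PT.lam_inst0_inst0]
  exact .single (.beta _ q)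

/-- The abstraction is placed in a type whose two argument sets consist just of the reducts of `r`
and of `q`, so the body is tested on these alone. -/
theorem tlam₂_app_mem {C : Set PT} (hC : IsCR C) {s : Srt} {B r q : PT} (hr : r ∈ SN)
    (hq : q ∈ SN) (h : ∀ (t : Tm s) (r' q' : PT), Red r r' → Red q q' →
      (B.tinst0 s t).subst (PT.cons q' (PT.cons r' PT.var)) ∈ C) (t : Tm s) :
    PT.app (.app (.tapp s (PT.tlam₂ s B) t) r) q ∈ C := by
  have hr' := isStable_reducts hr
  have hq' := isStable_reducts hq
  -- The outer quantifier is interpreted over a one-point domain, as only the term argument matters.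
  refine app_mem hq' hC (app_mem hr' (isCR_sImp _ C) (tapp_mem (x := ())
    (F := fun _ => sImp {r' | Red r r'} (sImp {q' | Red q q'} C)) (isCR_sImp _ _)
    (tlam_mem_sAll (fun _ => isCR_sImp _ _) fun _ t => ?_) t) .refl) .refl
  refine lam_mem_sImp hr' (isCR_sImp _ _) fun r' hr => lam_mem_sImp hq' hC fun q' hq => ?_
  exact (PT.lam_inst0_inst0 _ _ _).symm ▸ h t r' q' hr hq

/-- The body of the numeral `n`. -/
def PT.numBody : ℕ → PT
  | 0 => .var 1
  | n + 1 => .app (.app (.tapp .num (.var 0) ITm.zero) (PT.tlam₂ .cls (numBody n))) (numBody n)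

/-- The numeral `n`: a proof-term of `N(n)`. -/
def PT.num (n : ℕ) : PT := PT.tlam₂ .cls (PT.numBody n)

theorem PT.numBody_tsubst (n : ℕ) (σ : Env Tm) : (PT.numBody n).tsubst σ = PT.numBody n := by
  induction n generalizing σ with
  | zero => rfl
  | succ n ih => simp [PT.numBody, PT.tsubst, PT.tlam₂, ih, Tm.subst, ITm.subst]

theorem PT.numBody_subst (n : ℕ) (θ : ℕ → PT) :
    (PT.numBody n).subst (upP (upP θ)) = PT.numBody n := by
  induction n generalizing θ with
  | zero => rfl
  | succ n ih => simp [PT.numBody, PT.subst, PT.tlam₂, ih, upP]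

theorem PT.num_subst (n : ℕ) (θ : ℕ → PT) : (PT.num n).subst θ = PT.num n := by
  simp [PT.num, PT.tlam₂, PT.subst, PT.numBody_subst]

theorem PT.numBody_succ_subst (n : ℕ) (a b : PT) :
    (PT.numBody (n + 1)).subst (PT.cons b (PT.cons a PT.var)) =
      .app (.app (.tapp .num b ITm.zero) (PT.num n))
        ((PT.numBody n).subst (PT.cons b (PT.cons a PT.var))) := by
  have h := PT.num_subst n (PT.cons b (PT.cons a PT.var))
  rw [PT.num] at h
  simp [PT.numBody, PT.subst, h, PT.num, PT.cons]

theorem Red.num (n : ℕ) (t : Tm .cls) (a b : PT) :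
    Red (.app (.app (.tapp .cls (PT.num n) t) a) b)
      ((PT.numBody n).subst (PT.cons b (PT.cons a PT.var))) := by
  have h := Red.tlam₂ .cls (PT.numBody n) t a b
  rwa [PT.tinst0, PT.numBody_tsubst] at h

theorem not_step_numBody (n : ℕ) (p : PT) : ¬ Step (PT.numBody n) p := by
  induction n generalizing p with
  | zero => intro h; cases h
  | succ n ih =>
    intro h
    cases h with
    | app_left _ h =>
      cases h with
      | app_left _ h => cases h with | tapp _ _ h => cases h
      | app_right _ h => cases h with | tlam _ h => cases h with | lam h => cases h with
        | lam h => exact ih _ h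
    | app_right _ h => exact ih _ h

theorem num_mem_SN (n : ℕ) : PT.num n ∈ SN :=
  SN.map (Step.tlam_inv _) <| SN.map Step.lam_inv <| SN.map Step.lam_inv <|
    SN.intro fun _ h => (not_step_numBody n _ h).elim

/-- The numeral is a recursor: its body at `n + 1` hands the step function both the numeral `n`, as
its proof of `N(n)`, and the result of `n` iterations. The strong induction provides the former, the
inner induction the latter. -/
theorem num_mem_Pfam (n : ℕ) : PT.num n ∈ Pfam n := by
  induction n using Nat.strong_induction_on with
  | _ n ih =>
    rw [← Phi_Pfam]
    refine ⟨num_mem_SN n, fun t a b hab => ?_⟩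
    refine tlam₂_app_mem (isCR_Cfam _ _ _ _) hab.1 hab.2.1 (fun t a' b' ha hb => ?_) t
    rw [PT.tinst0, PT.numBody_tsubst]
    clear t
    induction n with
    | zero => exact (isCR_Cfam _ _ _ _).red _ (mem_Cfam_zero _ hab.1) _ ha
    | succ n ihn =>
      rw [PT.numBody_succ_subst]
      have hn := ihn fun m hm => ih m (hm.trans (Nat.lt_succ_self n))
      have h := ih n (Nat.lt_succ_self n)
      -- The generators of the family have `b` itself at the head, so membership is shown with `b`
      -- there, and `b` is then reduced to `b'`.
      refine (isCR_Cfam _ _ _ _).red _ (mem_Cfam_succ h hn (hab.2.2 ITm.zero n _ h _ hn)) _ ?_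
      exact hb.lift (f := fun b => .app (.app (.tapp .num b ITm.zero) (PT.num n)) _)
        fun _ _ hs => ((hs.tapp _ _).app_left _).app_left _

/-- The identity under `k` pairs. -/
def PT.nest : ℕ → PT
  | 0 => .lam (.var 0)
  | k + 1 => .pair (nest k) .star

theorem PT.nest_subst (k : ℕ) (θ : ℕ → PT) : (PT.nest k).subst θ = PT.nest k := by
  induction k with
  | zero => rfl
  | succ k ih => simp [PT.nest, PT.subst, ih]

theorem PT.nest_tsubst (k : ℕ) (σ : Env Tm) : (PT.nest k).tsubst σ = PT.nest k := by
  induction k with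
  | zero => rfl
  | succ k ih => simp [PT.nest, PT.tsubst, ih]

theorem nest_mem_SN (k : ℕ) : PT.nest k ∈ SN := by
  induction k with
  | zero => exact SN.map Step.lam_inv (SN.var 0)
  | succ k ih => exact SN.pair ih SN.star

/-- The step function that takes first projections. -/
def PT.unnest : PT := PT.tlam₂ .num (.fst (.var 0))

theorem unnest_mem_SN : PT.unnest ∈ SN :=
  SN.map (Step.tlam_inv _) <| SN.map Step.lam_inv <| SN.map Step.lam_inv <|
    SN.intro fun _ h => by cases h with | fst h => cases h

/-- The candidate of `k`-fold nested pairs from which `j` first projections have been taken. -/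
def nestSet : ℕ → ℕ → Set PT
  | k, 0 => Csingle (PT.nest k)
  | 0, _ + 1 => botbot
  | k + 1, j + 1 => nestSet k j

theorem isCR_nestSet (k j : ℕ) : IsCR (nestSet k j) := by
  induction k, j using nestSet.induct with
  | case1 k => rw [nestSet]; exact isCR_Csingle (nest_mem_SN k)
  | case2 => rw [nestSet]; exact isCR_botbot
  | case3 k j ih => rwa [nestSet]

theorem fst_mem_nestSet {k j : ℕ} {p : PT} (hp : p ∈ nestSet k j) :
    PT.fst p ∈ nestSet k (j + 1) := by
  induction k, j using nestSet.induct with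
  | case1 k =>
    rw [nestSet] at hp
    cases k with
    | zero =>
      rw [nestSet]
      -- The identity never reduces to a pair, so it belongs to every conjunction, even one with
      -- left component `botbot`.
      refine fst_mem (C := SN) isCR_botbot (Csingle_subset (isCR_sAnd _ _) ?_ hp)
      refine ⟨nest_mem_SN 0, fun _ _ h => ?_⟩
      obtain ⟨_, h, _⟩ := Red.map_inv Step.lam_inv h
      cases h
    | succ k =>
      rw [nestSet, nestSet]
      exact fst_mem (C := SN) (isCR_Csingle (nest_mem_SN k)) (Csingle_subset (isCR_sAnd _ _)
        (pair_mem_sAnd (isCR_Csingle (nest_mem_SN k)) isCR_SN (mem_Csingle _) SN.star) hp)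
  | case2 =>
    rw [nestSet] at hp ⊢
    exact fst_mem (C := SN) isCR_botbot (botbot_subset (isCR_sAnd _ _) hp)
  | case3 k j ih =>
    rw [nestSet] at hp ⊢
    exact ih hp

/-- After `j` projections an identity is left if `j = k`, a pair if `j < k`, and a stuck projection
if `j > k`. In the last two cases no abstraction appears, so the condition for implication is
vacuous and even `botbot` can be the target. -/
theorem nestSet_subset_sImp (k j : ℕ) :
    nestSet k j ⊆ sImp SN (if j = k then SN else botbot) := by
  induction k, j using nestSet.induct with
  | case1 k =>
    rw [nestSet]
    refine Csingle_subset (isCR_sImp _ _) ?_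
    cases k with
    | zero => exact lam_mem_sImp isCR_SN.isStable isCR_SN fun _ hq => hq
    | succ k =>
      refine ⟨nest_mem_SN _, fun _ h => ?_⟩
      obtain ⟨_, _, h, _⟩ := Red.pair_inv h
      cases h
  | case2 => rw [nestSet]; exact botbot_subset (isCR_sImp _ _)
  | case3 k j ih => rw [nestSet]; simpa using ih

theorem Cfam_nest_subset {P : ℕ → Set PT} (hP : ∀ n, IsCR (P n)) (k j : ℕ) :
    Cfam (PT.nest k) PT.unnest P j ⊆ nestSet k j := by
  refine Cfam_subset (isCR_nestSet k) (fun _ => ?_) (fun n t r hr q hq hq' _ => ?_) j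
  · cases k <;> exact mem_Csingle _
  · refine tlam₂_app_mem (isCR_nestSet _ _) ((hP n).sn _ hr) ((isCR_nestSet _ _).sn _ hq')
      (fun t r' q' _ h => ?_) t
    exact fst_mem_nestSet ((isCR_nestSet _ _).red _ hq' _ h)

theorem isPeano_nest {P : ℕ → Set PT} (hP : ∀ n, IsCR (P n)) (k : ℕ) :
    IsPeano P (PT.nest k) PT.unnest := by
  refine ⟨nest_mem_SN k, unnest_mem_SN, fun t n r hr q hq => ?_⟩
  refine tlam₂_app_mem isCR_SN ((hP n).sn _ hr) ((isCR_Cfam _ _ _ _).sn _ hq)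
    (fun t r' q' _ h => ?_) t
  exact (isCR_nestSet _ _).sn _
    (fst_mem_nestSet (Cfam_nest_subset hP _ _ ((isCR_Cfam _ _ _ _).red _ hq _ h)))

/-- The outermost projection of the iteration acts last, so the induction needs the surplus depth
`i`: the inner `j` projections leave `i + 1` pairs for it. -/
theorem Red.numBody_nest (i j : ℕ) :
    Red ((PT.numBody j).subst (PT.cons PT.unnest (PT.cons (PT.nest (i + j)) PT.var)))
      (PT.nest i) := by
  induction j generalizing i with
  | zero => exact .refl
  | succ j ih =>
    rw [PT.numBody_succ_subst]
    refine (Red.tlam₂ .num _ _ _ _).trans ?_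
    have h := ih (i + 1)
    rw [show i + 1 + j = i + (j + 1) by omega] at h
    exact (h.lift (f := PT.fst) fun _ _ => Step.fst).tail (.fst_pair _ _)

/-- A step function that uses its second argument to return `q` exactly at the argument `k`. -/
def PT.pick (k : ℕ) (q : PT) : PT :=
  PT.tlam₂ .num (.app (.app (.app (.tapp .cls (.var 1) (KTm.var 0)) (PT.nest k)) PT.unnest)
    (((q.tsubst (wk .num)).ren Nat.succ).ren Nat.succ))

theorem PT.pick_body (k : ℕ) (q r p : PT) (t : Tm .num) :
    ((PT.app (.app (.app (.tapp .cls (.var 1) (KTm.var 0)) (PT.nest k)) PT.unnest)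
      (((q.tsubst (wk .num)).ren Nat.succ).ren Nat.succ)).tinst0 .num t).subst
        (PT.cons p (PT.cons r PT.var)) =
      .app (.app (.app (.tapp .cls r (KTm.var 0)) (PT.nest k)) PT.unnest) q := by
  have h : (((q.tsubst (wk .num)).ren Nat.succ).ren Nat.succ).tsubst (inst .num t) =
      (q.ren Nat.succ).ren Nat.succ := by
    rw [PT.tsubst_ren, PT.tsubst_ren, PT.tsubst_tsubst, inst, Env.comp_wk_push, PT.tsubst_id]
  rw [PT.tinst0]
  simp only [PT.tsubst, PT.subst, h, PT.nest_tsubst, PT.nest_subst, PT.ren_subst_cons,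
    PT.subst_id]
  rfl

/-- Here the fixed-point equation is essential: it lets any `r` in `Pfam j`, not just a numeral, be
run on the Peano pair of `nest k` and `unnest`, with result in `nestSet k j`. -/
theorem pick_app_mem (k j : ℕ) {q r p : PT} (hq : q ∈ SN) (hr : r ∈ Pfam j) (hp : p ∈ SN)
    (t : Tm .num) : PT.app (.app (.tapp .num (PT.pick k q) t) r) p ∈
      if j = k then SN else botbot := by
  have hC : IsCR (if j = k then SN else botbot) := by
    split
    · exact isCR_SN
    · exact isCR_botbot
  refine tlam₂_app_mem hC ((isCR_Pfam j).sn _ hr) hp (fun t r' p' hr' _ => ?_) t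
  rw [PT.pick_body]
  have h := (isCR_Pfam j).red _ hr _ hr'
  rw [← Phi_Pfam] at h
  exact app_mem isCR_SN.isStable hC (nestSet_subset_sImp k j (Cfam_nest_subset isCR_Pfam k j
    (h.2 _ _ _ (isPeano_nest isCR_Pfam k)))) hq

theorem Red.pick (k : ℕ) (q p : PT) (t : Tm .num) :
    Red (.app (.app (.tapp .num (PT.pick k q) t) (PT.num k)) p) q := by
  have h : Red (.app (.app (.tapp .num (PT.pick k q) t) (PT.num k)) p) _ := Red.tlam₂ .num _ _ _ _
  rw [PT.pick_body] at h
  have hk := Red.numBody_nest 0 k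
  rw [Nat.zero_add] at hk
  have h' : Red _ _ := (Red.num k (KTm.var 0) (PT.nest k) PT.unnest).trans hk
  exact (h.trans (h'.lift (f := fun p => PT.app p q) fun _ _ hs => hs.app_left q)).tail
    (.beta _ _)

theorem exists_Cfam_separating {n m : ℕ} (hnm : n ≠ m) {q : PT} (hq : q ∈ SN) :
    ∃ a b, q ∈ Cfam a b Pfam n ∧ Cfam a b Pfam m ⊆ botbot := by
  cases n with
  | zero =>
    -- With a variable as step function, every generator at a positive index is a variable applied
    -- to strongly normalizable arguments, hence lies in `botbot`.
    refine ⟨q, .var 0, mem_Cfam_zero _ hq, ?_⟩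
    obtain ⟨m, rfl⟩ := Nat.exists_eq_succ_of_ne_zero hnm.symm
    refine gen_subset isCR_botbot ?_
    rintro _ ⟨-, t, r, hr, p, hp, rfl⟩
    exact isCR_preimage_tapp (isCR_preimage_app (isCR_preimage_app isCR_botbot
      ((isCR_Cfam _ _ _ _).sn _ hp)) ((isCR_Pfam m).sn _ hr)) .num t |>.var 0
  | succ k =>
    -- The variable makes the value at `0` equal to `botbot`. At `j + 1` the step function receives
    -- an element of `Pfam j` and yields elements of `botbot` unless `j = k`.
    refine ⟨.var 0, PT.pick k q, ?_, ?_⟩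
    · have h := pick_app_mem k k hq (num_mem_Pfam k) (SN.var 0) ITm.zero
      rw [if_pos rfl] at h
      exact (isCR_Cfam _ _ _ _).red _
        (mem_Cfam_succ (num_mem_Pfam k) ((isCR_Cfam _ _ _ _).var 0) h) _ (Red.pick _ _ _ _)
    · cases m with
      | zero =>
        refine gen_subset isCR_botbot ?_
        rintro _ ⟨rfl, -⟩
        exact isCR_botbot.var 0
      | succ j =>
        refine gen_subset isCR_botbot ?_
        rintro _ ⟨-, t, r, hr, p, hp, rfl⟩
        have h := pick_app_mem k j hq hr ((isCR_Cfam _ _ _ _).sn _ hp) t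
        rwa [if_neg (by omega)] at h

/-! ## Countability -/

/-- A code for terms of sort `num`. -/
def ITm.code : ITm → ℕ
  | .var i => Nat.pair 0 i
  | .zero => Nat.pair 1 0
  | .succ a => Nat.pair 2 a.code
  | .pred a => Nat.pair 3 a.code
  | .add a b => Nat.pair 4 (Nat.pair a.code b.code)
  | .mul a b => Nat.pair 5 (Nat.pair a.code b.code)

theorem ITm.code_injective : Function.Injective ITm.code := by
  intro a
  induction a <;> intro b h <;> cases b <;> simp [ITm.code] at h ⊢ <;> grind

instance : Countable ITm := ITm.code_injective.countable

instance : Countable Srt :=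
  Function.Injective.countable (f := fun s : Srt => if s = .num then 0 else 1) (by
    intro s s'
    cases s <;> cases s' <;> simp)

/-- A code for propositions without membership, from codes of terms and sorts. -/
def Fml.code (c : ITm → ℕ) (d : Srt → ℕ) : Fml Empty → ℕ
  | .eq a b => Nat.pair 0 (Nat.pair (c a) (c b))
  | .null a => Nat.pair 1 (c a)
  | .nat a => Nat.pair 2 (c a)
  | .mem _ k => k.elim
  | .top => Nat.pair 3 0
  | .bot => Nat.pair 4 0
  | .imp A B => Nat.pair 5 (Nat.pair (A.code c d) (B.code c d))
  | .and A B => Nat.pair 6 (Nat.pair (A.code c d) (B.code c d))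
  | .or A B => Nat.pair 7 (Nat.pair (A.code c d) (B.code c d))
  | .all s A => Nat.pair 8 (Nat.pair (d s) (A.code c d))
  | .ex s A => Nat.pair 9 (Nat.pair (d s) (A.code c d))

theorem Fml.code_injective {c : ITm → ℕ} {d : Srt → ℕ} (hc : Function.Injective c)
    (hd : Function.Injective d) : Function.Injective (Fml.code c d) := by
  have hc' := fun a b => hc.eq_iff (a := a) (b := b)
  have hd' := fun a b => hd.eq_iff (a := a) (b := b)
  intro A
  induction A <;> intro B h <;> cases B <;>
    first | (exact Empty.elim ‹Empty›) | (simp [Fml.code, hc', hd'] at h ⊢ <;> grind)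

instance : Countable (Fml Empty) := by
  obtain ⟨c, hc⟩ := exists_injective_nat ITm
  obtain ⟨d, hd⟩ := exists_injective_nat Srt
  exact (Fml.code_injective hc hd).countable

instance : Countable KTm :=
  Function.Injective.countable (f := fun c : KTm => show ℕ ⊕ Σ n, Fml Empty × (Fin n → ITm) from
    match c with
    | .var i => .inl i
    | .comp n P _ ts => .inr ⟨n, P, ts⟩) (by
    intro c c' h
    cases c with
    | var => cases c' <;> simp_all
    | comp n P hP ts =>
      cases c' with
      | var => simp at h
      | comp n' P' hP' ts' =>
        obtain ⟨rfl, h⟩ := Sigma.mk.inj_iff.1 (Sum.inr_injective h)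
        cases h
        rfl)

instance (s : Srt) : Countable (Tm s) := by
  cases s
  · exact inferInstanceAs (Countable ITm)
  · exact inferInstanceAs (Countable KTm)

/-- A code for proof-terms, from codes of sorts and terms. -/
def PT.code (d : Srt → ℕ) (e : (Σ s, Tm s) → ℕ) : PT → ℕ
  | .var n => Nat.pair 0 n
  | .lam p => Nat.pair 1 (p.code d e)
  | .app p q => Nat.pair 2 (Nat.pair (p.code d e) (q.code d e))
  | .pair p q => Nat.pair 3 (Nat.pair (p.code d e) (q.code d e))
  | .fst p => Nat.pair 4 (p.code d e)
  | .snd p => Nat.pair 5 (p.code d e)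
  | .inl p => Nat.pair 6 (p.code d e)
  | .inr p => Nat.pair 7 (p.code d e)
  | .case p q r => Nat.pair 8 (Nat.pair (p.code d e) (Nat.pair (q.code d e) (r.code d e)))
  | .star => Nat.pair 9 0
  | .abort p => Nat.pair 10 (p.code d e)
  | .tlam s p => Nat.pair 11 (Nat.pair (d s) (p.code d e))
  | .tapp s p t => Nat.pair 12 (Nat.pair (e ⟨s, t⟩) (p.code d e))
  | .tpair s t p => Nat.pair 13 (Nat.pair (e ⟨s, t⟩) (p.code d e))
  | .tcase s p q => Nat.pair 14 (Nat.pair (d s) (Nat.pair (p.code d e) (q.code d e)))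

theorem PT.code_injective {d : Srt → ℕ} {e : (Σ s, Tm s) → ℕ} (hd : Function.Injective d)
    (he : Function.Injective e) : Function.Injective (PT.code d e) := by
  have hd' := fun a b => hd.eq_iff (a := a) (b := b)
  have he' := fun a b => he.eq_iff (a := a) (b := b)
  intro p
  induction p <;> intro q h <;> cases q <;>
    simp [PT.code, hd', he'] at h ⊢ <;> grind

instance : Countable PT := by
  obtain ⟨d, hd⟩ := exists_injective_nat Srt
  obtain ⟨e, he⟩ := exists_injective_nat (Σ s, Tm s)
  exact (PT.code_injective hd he).countable

/-! ## Propositions without membership in arithmetical pre-models -/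

/-- The comprehension operations on the class domain `I`. -/
abbrev CompFun (I : Type) : Type :=
  (n : ℕ) → (P : Fml Empty) → P.Bdd (n + 1) → (Fin n → ℕ) → I

/-- One bound `N` serves all models, so a single induction shows both independence of the class
domain and dependence on finitely many variables. -/
theorem ITm.exists_den_congr (a : ITm) : ∃ N : ℕ, ∀ (I I' : Type) (U : I → ℕ → Set PT)
    (U' : I' → ℕ → Set PT) (c : CompFun I) (c' : CompFun I') (φ : Env (dom I)) (φ' : Env (dom I')),
    (∀ i < N, φ .num i = φ' .num i) →
    a.den (arithModel I U c) φ = a.den (arithModel I' U' c') φ' := by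
  induction a with
  | var i => exact ⟨i + 1, fun _ _ _ _ _ _ φ φ' h => h i (Nat.lt_succ_self i)⟩
  | zero => exact ⟨0, fun _ _ _ _ _ _ _ _ _ => rfl⟩
  | succ a ih =>
    obtain ⟨N, hN⟩ := ih
    exact ⟨N, fun I I' U U' c c' φ φ' h => congrArg (fun n : ℕ => n + 1) (hN I I' U U' c c' φ φ' h)⟩
  | pred a ih =>
    obtain ⟨N, hN⟩ := ih
    exact ⟨N, fun I I' U U' c c' φ φ' h => congrArg (fun n : ℕ => n - 1) (hN I I' U U' c c' φ φ' h)⟩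
  | add a b iha ihb =>
    obtain ⟨N, hN⟩ := iha
    obtain ⟨N', hN'⟩ := ihb
    exact ⟨max N N', fun I I' U U' c c' φ φ' h => congrArg₂ (fun n m : ℕ => n + m)
      (hN I I' U U' c c' φ φ' fun i hi => h i (lt_max_of_lt_left hi))
      (hN' I I' U U' c c' φ φ' fun i hi => h i (lt_max_of_lt_right hi))⟩
  | mul a b iha ihb =>
    obtain ⟨N, hN⟩ := iha
    obtain ⟨N', hN'⟩ := ihb
    exact ⟨max N N', fun I I' U U' c c' φ φ' h => congrArg₂ (fun n m : ℕ => n * m)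
      (hN I I' U U' c c' φ φ' fun i hi => h i (lt_max_of_lt_left hi))
      (hN' I I' U U' c c' φ φ' fun i hi => h i (lt_max_of_lt_right hi))⟩

theorem Env.push_num_agree {I I' : Type} {φ : Env (dom I)} {φ' : Env (dom I')} {N : ℕ}
    (h : ∀ i < N, φ .num i = φ' .num i) (n : ℕ) :
    ∀ i < N, φ.push .num n .num i = φ'.push .num n .num i := by
  intro i hi
  cases i with
  | zero => simp
  | succ i => simpa using h i (by omega)

theorem sAll_congr_nonempty {s : Srt} {X Y : Type} [Nonempty X] [Nonempty Y] {F : X → Set PT}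
    {G : Y → Set PT} (h : ∀ x y, F x = G y) : sAll s F = sAll s G := by
  ext p
  refine and_congr_right fun _ => forall₂_congr fun p' _ => ⟨fun H y t => ?_, fun H x t => ?_⟩
  · exact h (Classical.arbitrary X) y ▸ H _ t
  · exact (h x (Classical.arbitrary Y)).symm ▸ H _ t

theorem sEx_congr_nonempty {s : Srt} {X Y : Type} [Nonempty X] [Nonempty Y] {F : X → Set PT}
    {G : Y → Set PT} (h : ∀ x y, F x = G y) : sEx s F = sEx s G := by
  ext p
  refine and_congr_right fun _ => forall₃_congr fun t p' _ => ⟨?_, ?_⟩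
  · rintro ⟨x, hx⟩
    exact ⟨Classical.arbitrary Y, h x _ ▸ hx⟩
  · rintro ⟨y, hy⟩
    exact ⟨Classical.arbitrary X, (h _ y).symm ▸ hy⟩

/-- The denotation of a proposition without membership depends neither on the class domain nor on
the values of all but finitely many variables. -/
theorem Fml.exists_den₀_congr (A : Fml Empty) : ∃ N : ℕ, ∀ (I I' : Type) [Nonempty I] [Nonempty I']
    (U : I → ℕ → Set PT) (U' : I' → ℕ → Set PT) (c : CompFun I) (c' : CompFun I')
    (φ : Env (dom I)) (φ' : Env (dom I')), (∀ i < N, φ .num i = φ' .num i) →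
    (arithModel I U c).den₀ φ A = (arithModel I' U' c').den₀ φ' A := by
  induction A with
  | eq a b =>
    obtain ⟨N, hN⟩ := a.exists_den_congr
    obtain ⟨N', hN'⟩ := b.exists_den_congr
    exact ⟨max N N', fun I I' _ _ U U' c c' φ φ' h => congrArg₂ (arithModel I U c).eq
      (hN I I' U U' c c' φ φ' fun i hi => h i (lt_max_of_lt_left hi))
      (hN' I I' U U' c c' φ φ' fun i hi => h i (lt_max_of_lt_right hi))⟩
  -- `Null` denotes `SN` at every number.
  | null a => exact ⟨0, fun _ _ _ _ _ _ _ _ _ _ _ => rfl⟩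
  | nat a =>
    obtain ⟨N, hN⟩ := a.exists_den_congr
    exact ⟨N, fun I I' _ _ U U' c c' φ φ' h => congrArg Pfam (hN I I' U U' c c' φ φ' h)⟩
  | mem a k => exact k.elim
  | top => exact ⟨0, fun _ _ _ _ _ _ _ _ _ _ _ => rfl⟩
  | bot => exact ⟨0, fun _ _ _ _ _ _ _ _ _ _ _ => rfl⟩
  | imp A B ihA ihB =>
    obtain ⟨N, hN⟩ := ihA
    obtain ⟨N', hN'⟩ := ihB
    exact ⟨max N N', fun I I' _ _ U U' c c' φ φ' h => congrArg₂ sImp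
      (hN I I' U U' c c' φ φ' fun i hi => h i (lt_max_of_lt_left hi))
      (hN' I I' U U' c c' φ φ' fun i hi => h i (lt_max_of_lt_right hi))⟩
  | and A B ihA ihB =>
    obtain ⟨N, hN⟩ := ihA
    obtain ⟨N', hN'⟩ := ihB
    exact ⟨max N N', fun I I' _ _ U U' c c' φ φ' h => congrArg₂ sAnd
      (hN I I' U U' c c' φ φ' fun i hi => h i (lt_max_of_lt_left hi))
      (hN' I I' U U' c c' φ φ' fun i hi => h i (lt_max_of_lt_right hi))⟩
  | or A B ihA ihB =>
    obtain ⟨N, hN⟩ := ihA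
    obtain ⟨N', hN'⟩ := ihB
    exact ⟨max N N', fun I I' _ _ U U' c c' φ φ' h => congrArg₂ sOr
      (hN I I' U U' c c' φ φ' fun i hi => h i (lt_max_of_lt_left hi))
      (hN' I I' U U' c c' φ φ' fun i hi => h i (lt_max_of_lt_right hi))⟩
  | all s A ih =>
    obtain ⟨N, hN⟩ := ih
    refine ⟨N, fun I I' _ _ U U' c c' φ φ' h => ?_⟩
    cases s with
    | num =>
      exact congrArg (sAll .num) (funext fun n : ℕ =>
        hN I I' U U' c c' _ _ (Env.push_num_agree h n))
    | cls =>
      -- A class quantifier changes no numerical variable, so it is vacuous over any non-empty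
      -- domain.
      exact sAll_congr_nonempty (X := I) (Y := I') fun x y =>
        hN I I' U U' c c' (φ.push .cls x) (φ'.push .cls y) h
  | ex s A ih =>
    obtain ⟨N, hN⟩ := ih
    refine ⟨N, fun I I' _ _ U U' c c' φ φ' h => ?_⟩
    cases s with
    | num =>
      exact congrArg (sEx .num) (funext fun n : ℕ =>
        hN I I' U U' c c' _ _ (Env.push_num_agree h n))
    | cls =>
      exact sEx_congr_nonempty (X := I) (Y := I') fun x y =>
        hN I I' U U' c c' (φ.push .cls x) (φ'.push .cls y) h

theorem den₀_eq_defFun {I : Type} [Nonempty I] (U : I → ℕ → Set PT) (c : CompFun I)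
    (P : Fml Empty) (φ : Env (dom I)) (n : ℕ) :
    (arithModel I U c).den₀ (φ.push .num n) P = defFun P (φ .num) n := by
  obtain ⟨N, hN⟩ := P.exists_den₀_congr
  exact hN _ _ _ _ _ _ _ _ (Env.push_num_agree (fun _ _ => rfl) n)

theorem exists_defFun_congr (P : Fml Empty) : ∃ N : ℕ, ∀ φ φ' : ℕ → ℕ, (∀ i < N, φ i = φ' i) →
    defFun P φ = defFun P φ' := by
  obtain ⟨N, hN⟩ := P.exists_den₀_congr
  exact ⟨N, fun φ φ' h => funext fun n => hN _ _ _ _ _ _ _ _ (Env.push_num_agree h n)⟩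

theorem countable_MKset : MKset.Countable := by
  refine .union (.union ?_ ?_) ?_
  -- Finitely many values of the assignment matter, so a finite list of them determines the
  -- definable function.
  · refine (Set.countable_range fun x : Fml Empty × List ℕ =>
      defFun x.1 fun i => x.2.getD i 0).mono ?_
    rintro _ ⟨P, φ, rfl⟩
    obtain ⟨N, hN⟩ := exists_defFun_congr P
    refine ⟨(P, (List.range N).map φ), hN _ _ fun i hi => ?_⟩
    simp [List.getD, hi]
  · refine (Set.countable_range fun q : PT => fun _ : ℕ => Csingle q).mono ?_
    rintro _ ⟨q, -, rfl⟩
    exact ⟨q, rfl⟩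
  · refine (Set.countable_range fun x : PT × PT => Cfam x.1 x.2 Pfam).mono ?_
    rintro _ ⟨a, b, rfl⟩
    exact ⟨(a, b), rfl⟩

/-! ## The rewrite rules in arithmetical pre-models -/

section Model

variable {I : Type} {U : I → ℕ → Set PT} {c : CompFun I}

theorem isPreModel_arithModel (hU : ∀ i n, IsCR (U i n)) : (arithModel I U c).IsPreModel where
  eq_cr (a b : ℕ) := by
    change IsCR (if a = b then E else E')
    split
    · exact isCR_E
    · exact isCR_E'
  null_cr _ := isCR_SN
  nat_cr n := isCR_Pfam n
  mem_cr n i := hU i n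

theorem isCR_of_mem_MKset {f : ℕ → Set PT} (hf : f ∈ MKset) (n : ℕ) : IsCR (f n) := by
  rcases hf with (⟨P, φ, rfl⟩ | ⟨q, hq, rfl⟩) | ⟨a, b, rfl⟩
  · exact (isPreModel_arithModel fun _ _ => isCR_SN).isCR_denWith _ P _
  · exact isCR_Csingle hq
  · exact isCR_Cfam _ _ _ _

theorem Csingle_mem_MKset {q : PT} (hq : q ∈ SN) : (fun _ => Csingle q) ∈ MKset :=
  .inl (.inr ⟨q, hq, rfl⟩)

theorem Cfam_mem_MKset (a b : PT) : Cfam a b Pfam ∈ MKset := .inr ⟨a, b, rfl⟩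

instance : Nonempty MK := ⟨⟨_, Csingle_mem_MKset SN.star⟩⟩

theorem nonempty_of_range_eq (hU : Set.range U = MKset) : Nonempty I := by
  have h := Csingle_mem_MKset SN.star
  rw [← hU] at h
  exact ⟨h.choose⟩

/-- Class quantification depends only on the range of the indexing, so `M_κ` and all its
enumerations are treated at once. -/
theorem sAll_range_eq {s : Srt} (hU : Set.range U = MKset) (G : (ℕ → Set PT) → Set PT) :
    sAll s (fun i => G (U i)) = sAll s fun f : MK => G f := by
  ext p
  refine and_congr_right fun _ => forall₂_congr fun p' _ => ⟨fun H f t => ?_, fun H i t => ?_⟩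
  · obtain ⟨i, hi⟩ := hU.superset f.2
    change _ ∈ G f.1
    rw [← hi]
    exact H i t
  · exact H ⟨U i, hU.subset ⟨i, rfl⟩⟩ t

/-- Forwards, `Csingle q` and `botbot` are minimal candidates. Backwards, the tests are the constant
functions if `n = m`, and the separating families otherwise. -/
theorem eq_rule_sets (n m : ℕ) :
    (if n = m then E else E') = sAll .cls fun f : MK => sImp (f.1 n) (f.1 m) := by
  have cr : ∀ (f : MK) k, IsCR (f.1 k) := fun f => isCR_of_mem_MKset f.2
  ext p
  rw [mem_sAll_iff fun _ => isCR_sImp _ _]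
  simp only [mem_sImp_iff (cr _ _).isStable (cr _ _)]
  constructor
  · intro h f t q hq
    have hqs := (cr f n).sn q hq
    split at h
    · rename_i hnm
      exact Csingle_subset (cr f m) (hnm.subst (motive := fun k => q ∈ f.1 k) hq) (h.2 t q hqs)
    · exact botbot_subset (cr f m) (h.2 t q hqs)
  · intro h
    have hp : p ∈ SN := SN.of_tapp (SN.of_app_left ((isCR_Csingle SN.star).sn _
      (h ⟨_, Csingle_mem_MKset SN.star⟩ (KTm.var 0) _ (mem_Csingle _))))
    split
    · exact ⟨hp, fun t q hq => h ⟨_, Csingle_mem_MKset hq⟩ t q (mem_Csingle q)⟩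
    · rename_i hnm
      refine ⟨hp, fun t q hq => ?_⟩
      obtain ⟨a, b, hn, hm⟩ := exists_Cfam_separating hnm hq
      exact hm (h ⟨_, Cfam_mem_MKset a b⟩ t q hn)

/-- Both directions go through `Phi_Pfam`. Forwards, the families `Cfam a b Pfam` are least among
those that satisfy the premises of induction; backwards, they belong to `M_κ` and satisfy these
premises for a Peano pair. -/
theorem nat_rule_sets (n : ℕ) :
    Pfam n = sAll .cls fun f : MK => sImp (f.1 0) (sImp
      (sAll .num fun k : ℕ => sImp (Pfam k) (sImp (f.1 k) (f.1 (k + 1)))) (f.1 n)) := by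
  have cr : ∀ (f : MK) k, IsCR (f.1 k) := fun f => isCR_of_mem_MKset f.2
  have hstep : ∀ (f : MK) p, p ∈ sAll .num (fun k : ℕ => sImp (Pfam k)
      (sImp (f.1 k) (f.1 (k + 1)))) ↔ ∀ k t, ∀ r ∈ Pfam k, ∀ q ∈ f.1 k,
        PT.app (.app (.tapp .num p t) r) q ∈ f.1 (k + 1) := by
    intro f p
    rw [mem_sAll_iff fun _ => isCR_sImp _ _]
    simp only [mem_sImp_iff (isCR_Pfam _).isStable (isCR_sImp _ _),
      mem_sImp_iff (cr _ _).isStable (cr _ _)]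
  ext p
  rw [mem_sAll_iff fun _ => isCR_sImp _ _]
  simp only [mem_sImp_iff (cr _ _).isStable (isCR_sImp _ _),
    mem_sImp_iff (isCR_sAll _ _).isStable (cr _ _)]
  constructor
  · intro h f t a ha b hb
    have hbs := (isCR_sAll _ _).sn _ hb
    rw [hstep] at hb
    have hsub : ∀ k, Cfam a b Pfam k ⊆ f.1 k :=
      Cfam_subset (cr f) (fun _ => ha) fun k t r hr q _ hq _ => hb k t r hr q hq
    rw [← Phi_Pfam] at h
    exact hsub n (h.2 t a b ⟨(cr f 0).sn _ ha, hbs, fun t k r hr q hq =>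
      (cr f _).sn _ (hb k t r hr q (hsub k hq))⟩)
  · intro h
    rw [← Phi_Pfam]
    refine ⟨?_, fun t a b hab => ?_⟩
    · let f : MK := ⟨_, Csingle_mem_MKset SN.star⟩
      exact SN.of_tapp (SN.of_app_left (SN.of_app_left ((cr f n).sn _
        (h f (KTm.var 0) _ (mem_Csingle _) _ ((isCR_sAll _ _).var 0)))))
    · refine h ⟨_, Cfam_mem_MKset a b⟩ t a (mem_Cfam_zero (b := b) Pfam hab.1) b ?_
      rw [hstep]
      exact fun k t r hr q hq => mem_Cfam_succ hr hq (hab.2.2 t k r hr q hq)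

theorem ITm.den_push_cls (a : ITm) (φ : Env (dom I)) (i : I) :
    a.den (arithModel I U c) (φ.push .cls i) = a.den (arithModel I U c) φ := by
  obtain ⟨N, hN⟩ := a.exists_den_congr
  exact hN _ _ _ _ _ _ _ _ fun _ _ => rfl

theorem den_eq_rule (hU : Set.range U = MKset) (a b : ITm) (φ : Env (dom I)) :
    (arithModel I U c).den φ (.eq a b) = (arithModel I U c).den φ (eqRhs a b) := by
  refine (eq_rule_sets _ _).trans ((sAll_range_eq hU fun f =>
    sImp (f (a.den (arithModel I U c) φ)) (f (b.den (arithModel I U c) φ))).symm.trans ?_)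
  refine congrArg (sAll .cls) (funext fun i => ?_)
  rw [← a.den_push_cls φ i, ← b.den_push_cls φ i]
  rfl

theorem den_nat_rule (hU : Set.range U = MKset) (a : ITm) (φ : Env (dom I)) :
    (arithModel I U c).den φ (.nat a) = (arithModel I U c).den φ (natRhs a) := by
  refine (nat_rule_sets _).trans ((sAll_range_eq hU fun f => sImp (f 0) (sImp
    (sAll .num fun k : ℕ => sImp (Pfam k) (sImp (f k) (f (k + 1))))
    (f (a.den (arithModel I U c) φ)))).symm.trans ?_)
  refine congrArg (sAll .cls) (funext fun i => ?_)
  rw [← a.den_push_cls φ i]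
  rfl

theorem apply_pad {X Y : Type} (f : X → Y) (x : X) {n : ℕ} (b : Fin n → X) (i : ℕ) :
    f (pad x b i) = pad (f x) (fun j => f (b j)) i := by
  unfold pad
  split <;> rfl

theorem den_comp_rule [Nonempty I] (hc : ∀ n P h b, U (c n P h b) = defFun P (pad 0 b)) (a : ITm)
    (n : ℕ) (P : Fml Empty) (h : P.Bdd (n + 1)) (ts : Fin n → ITm) (φ : Env (dom I)) :
    (arithModel I U c).den φ (.mem a (.comp n P h ts)) =
      (arithModel I U c).den φ (compRhs P a ts) := by
  have hP : (arithModel I U c).den φ (compRhs P a ts) = (arithModel I U c).den₀ _ P :=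
    Fml.denWith_substWith (M := arithModel I U c) (fun _ _ e => e.elim) P _ φ
  refine ((congrFun (hc n P h _) _).trans ?_).trans hP.symm
  obtain ⟨N, hN⟩ := P.exists_den₀_congr
  refine hN _ _ _ _ _ _ _ _ fun i _ => ?_
  cases i with
  | zero => rfl
  | succ i =>
    -- The paddings agree because the term `ITm.zero` denotes the number `0`.
    change pad (X := ℕ) 0 (fun i => (ts i).den (arithModel I U c) φ) i = ITm.den (arithModel I U c) φ (pad ITm.zero ts i)
    exact (apply_pad (ITm.den (arithModel I U c) φ) ITm.zero ts i).symm

theorem ITm.Rule.den_eq {a b : ITm} (h : ITm.Rule a b) (φ : Env (dom I)) :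
    a.den (arithModel I U c) φ = b.den (arithModel I U c) φ := by
  cases h with
  | pred_zero => rfl
  | pred_succ x => rfl
  | zero_add y => exact Nat.zero_add _
  | succ_add x y => exact Nat.succ_add _ _
  | zero_mul y => exact Nat.zero_mul _
  | succ_mul x y => exact Nat.succ_mul _ _

theorem ITm.Cong.den_eq {a b : ITm} (h : ITm.Cong a b) (φ : Env (dom I)) :
    a.den (arithModel I U c) φ = b.den (arithModel I U c) φ := by
  induction h with
  | rule h => exact h.den_eq φ
  | refl => rfl
  | symm _ ih => exact ih.symm
  | trans _ _ ih₁ ih₂ => exact ih₁.trans ih₂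
  | succ _ ih => simp only [ITm.den, ih]
  | pred _ ih => simp only [ITm.den, ih]
  | add _ _ ih₁ ih₂ => simp only [ITm.den, ih₁, ih₂]
  | mul _ _ ih₁ ih₂ => simp only [ITm.den, ih₁, ih₂]

theorem KTm.Cong.den_eq {k k' : KTm} (h : KTm.Cong k k') (φ : Env (dom I)) :
    k.den (arithModel I U c) φ = k'.den (arithModel I U c) φ := by
  cases h with
  | var => rfl
  | comp n P hP h =>
    exact congrArg ((arithModel I U c).comp n P hP) (funext fun i => (h i).den_eq φ)

theorem modelsCong_arithModel (hU : Set.range U = MKset)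
    (hc : ∀ n P h b, U (c n P h b) = defFun P (pad 0 b)) : (arithModel I U c).ModelsCong := by
  have := nonempty_of_range_eq hU
  intro A B h
  induction h with
  | rule h =>
    intro φ
    cases h with
    | eq a b => exact den_eq_rule hU a b φ
    | nat a => exact den_nat_rule hU a φ
    | comp a n P h ts => exact den_comp_rule hc a n P h ts φ
    | null_zero => rfl
    | null_succ => rfl
  | refl => exact fun _ => rfl
  | symm _ ih => exact fun φ => (ih φ).symm
  | trans _ _ ih₁ ih₂ => exact fun φ => (ih₁ φ).trans (ih₂ φ)
  | eq h h' => exact fun φ => congrArg₂ (arithModel I U c).eq (h.den_eq φ) (h'.den_eq φ)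
  | null h => exact fun φ => congrArg (arithModel I U c).null (h.den_eq φ)
  | nat h => exact fun φ => congrArg (arithModel I U c).nat (h.den_eq φ)
  | mem h h' => exact fun φ => congrArg₂ (arithModel I U c).mem (h.den_eq φ) (h'.den_eq φ)
  | imp _ _ ih₁ ih₂ => exact fun φ => congrArg₂ sImp (ih₁ φ) (ih₂ φ)
  | and _ _ ih₁ ih₂ => exact fun φ => congrArg₂ sAnd (ih₁ φ) (ih₂ φ)
  | or _ _ ih₁ ih₂ => exact fun φ => congrArg₂ sOr (ih₁ φ) (ih₂ φ)
  | all s _ ih => exact fun φ => congrArg (sAll s) (funext fun X => ih (φ.push s X))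
  | ex s _ ih => exact fun φ => congrArg (sEx s) (funext fun X => ih (φ.push s X))

end Model

/-! ### The class domain `M_κ` and its enumerations. -/

theorem theModel_modelsCong : theModel.ModelsCong :=
  modelsCong_arithModel Subtype.range_coe fun _ _ _ _ => rfl

theorem theModel_isPreModel : theModel.IsPreModel :=
  isPreModel_arithModel fun f => isCR_of_mem_MKset f.2

theorem range_enumeration {U : ℕ → MK} (hU : Function.Surjective U) :
    Set.range (fun m => (U m).val) = MKset := by
  rw [show (fun m => (U m).val) = Subtype.val ∘ U from rfl, hU.range_comp, Subtype.range_coe]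

end HAMod

theorem mainTheorem3 :
    -- `Pfam` is the least fixed point of `Phi` among the sequences of reducibility candidates
    IsLeast {Q : ℕ → Set PT | (∀ n, IsCR (Q n)) ∧ Phi Q = Q} Pfam ∧
    -- `M_κ` is countable, and its members are functions into the reducibility candidates
    MKset.Countable ∧ (∀ f ∈ MKset, ∀ n, IsCR (f n)) ∧
    -- the construction yields a pre-model
    theModel.IsPreModel ∧
    -- denotations of propositions without `∈` in it are those used to define `M_κ`
    (∀ (P : Fml Empty) (φ : Env (dom MK)) (n : ℕ),
      theModel.den₀ (Env.push φ .num n) P = defFun P (φ .num) n) ∧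
    -- the rule `a = b ⟶ ∀ p (a ∈ p ⇒ b ∈ p)` is valid
    (∀ (a b : ITm) (φ : Env theModel.D),
      theModel.den φ (.eq a b) = theModel.den φ (eqRhs a b)) ∧
    -- the rule `N(a) ⟶ ∀ p (0 ∈ p ⇒ ∀ y (N(y) ⇒ y ∈ p ⇒ S(y) ∈ p) ⇒ a ∈ p)` is valid
    (∀ (a : ITm) (φ : Env theModel.D),
      theModel.den φ (.nat a) = theModel.den φ (natRhs a)) ∧
    -- it is a pre-model of the congruence of all the rewrite rules
    theModel.ModelsCong ∧
    -- so is the pre-model in which `M_κ` is replaced by `ℕ` through an enumeration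
    (∃ U : ℕ → MK, Function.Surjective U) ∧
    (∀ (U : ℕ → MK) (hU : Function.Surjective U),
      (indexedModel U hU).IsPreModel ∧ (indexedModel U hU).ModelsCong) ∧
    -- cut elimination: all proofs modulo the congruence are strongly normalizable
    (∀ (Γ : List Prp) (p : PT) (A : Prp), Proves Γ p A → p ∈ SN) := by
  refine ⟨isLeast_Pfam, countable_MKset, fun f hf => isCR_of_mem_MKset hf, theModel_isPreModel,
    fun P φ n => den₀_eq_defFun _ _ P φ n, fun a b φ => den_eq_rule Subtype.range_coe a b φ,
    fun a φ => den_nat_rule Subtype.range_coe a φ, theModel_modelsCong, ?_, fun U hU => ⟨?_, ?_⟩,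
    fun Γ p A h => ?_⟩
  · have := countable_MKset.to_subtype
    exact exists_surjective_nat MK
  · exact isPreModel_arithModel fun m => isCR_of_mem_MKset (U m).2
  · refine modelsCong_arithModel (range_enumeration hU) fun n P h b => ?_
    exact congrArg Subtype.val (Function.surjInv_eq hU (compMK n P h b))
  · exact h.mem_SN theModel_isPreModel theModel_modelsCong
      (fun | .num => fun _ => (0 : ℕ) | .cls => fun _ => Classical.arbitrary MK)
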